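/- Let $\mathrm{CartSp}$ be the category of the spaces $\mathbb{R}^m$ ($m\ge 0$) and smooth maps, and let $n\ge 1$. Let $\Delta^k=\{t\in\mathbb{R}^k : t_i\ge 0,\ \sum_i t_i\le 1\}$ with ordered vertices $0,e_1,\dots,e_k$; forms on $U\times\Delta^k$ are smooth up to the boundary. A *smooth $\infty$-groupoid* is a simplicial presheaf on $\mathrm{CartSp}$ whose values are Kan complexes. For $U\in\mathrm{CartSp}$ let $\exp_\Delta(b^{n-1}\mathbb{R})_{\mathrm{diff}}(U)_k$ be the vector space of those $\alpha\in\Omega^n(U\times\Delta^k)$ for which $d\alpha$ vanishes on every $(n+1)$-tuple of vectors tangent to $\Delta^k$, and let $\exp_\Delta(b^{n-1}\mathbb{R})_{\mathrm{conn}}(U)_k$ be the subspace of those $\alpha$ with $\iota_v d\alpha=0$ for every vector $v$ tangent to $\Delta^k$. With pullback along $f\times\theta_*$, for smooth maps $f$ of Cartesian spaces and the affine maps $\theta_*$ of simplices given by monotone maps $\theta$, these are simplicial presheaves of real vector spaces. Let $\mathrm{Del}_n$ be the Deligne complex $C^\infty\to\Omega^1\to\cdots\to\Omega^n$ of presheaves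 of vector spaces with $\Omega^n$ in degree $0$ (so $\Omega^{n-k}$ is in degree $k$), with the de Rham differential. Let $\mathrm{Cone}_n$ be the complex with $\Omega^{n}$ in degree $0$, with $\Omega^{n-k}\oplus\Omega^{n-k+1}$ in degree $k$ for $1\le k\le n$, and with $0$ in degrees $k>n$; its differential from degree $k\geq 1$ to degree $k-1$ is $$(a,b)\longmapsto\bigl(da+(-1)^{k-1}b,\ db\bigr),$$ where the second entry is omitted for $k=1$. It is the mapping cone of the inclusion of $(\Omega^1\to\cdots\to\Omega^n)$ into $\mathrm{Del}_n$, and $a\mapsto(a,0)$ embeds $\mathrm{Del}_n$ into it. Let $\mathbf{B}^n\mathbb{R}_{\mathrm{conn}}$ and $\mathbf{B}^n\mathbb{R}_{\mathrm{diff}}$ be the simplicial presheaves that correspond to $\mathrm{Del}_n$ and $\mathrm{Cone}_n$ under the Dold–Kan correspondence, so that $\mathbf{B}^n\mathbb{R}_{\mathrm{conn}}\hookrightarrow\mathbf{B}^n\mathbb{R}_{\mathrm{diff}}$. For a form $\alpha$ on $U\times\Delta^k$ let $\int_{\Delta^k}\alpha=\int_{\Delta^k}\bigl(\iota_{\partial/\partial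 t_1}\cdots\iota_{\partial/\partial t_k}\alpha\bigr)\,dt_1\cdots dt_k$, restricted to vectors tangent to $U$; it is a form on $U$ of degree lower by $k$, and $0$ if $k>\deg\alpha$. Then the following hold. 1. For $\alpha\in\exp_\Delta(b^{n-1}\mathbb{R})_{\mathrm{diff}}(U)_k$ the pair $\bigl(\int_{\Delta^k}\alpha,\ \int_{\Delta^k}d\alpha\bigr)$ consists of smooth forms and is natural in $U$ and linear in $\alpha$ (for $k=0$ only the first entry is taken). The assignment $\alpha\mapsto\bigl(\int_{\Delta^k}\alpha,\int_{\Delta^k}d\alpha\bigr)$ is a chain map to $\mathrm{Cone}_n$ from the complex of all cells of $\exp_\Delta(b^{n-1}\mathbb{R})_{\mathrm{diff}}$ with the alternating sum of the faces as differential. It vanishes on degenerate cells, and thus it restricts to a chain map on the normalized complex. 2. On $\exp_\Delta(b^{n-1}\mathbb{R})_{\mathrm{conn}}$ this chain map takes values in the subcomplex $\mathrm{Del}_n$. 3. The simplicial presheaves $\exp_\Delta(b^{n-1}\mathbb{R})_{\mathrm{diff}}$, $\exp_\Delta(b^{n-1}\mathbb{R})_{\mathrm{conn}}$, $\mathbf{B}^n\mathbb{R}_{\mathrm{diff}}$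 and $\mathbf{B}^n\mathbb{R}_{\mathrm{conn}}$ are smooth $\infty$-groupoids, and the chain maps on the normalized complexes induce, under the Dold–Kan correspondence, morphisms $$\exp_\Delta(b^{n-1}\mathbb{R})_{\mathrm{diff}}\to\mathbf{B}^n\mathbb{R}_{\mathrm{diff}},\qquad \exp_\Delta(b^{n-1}\mathbb{R})_{\mathrm{conn}}\to\mathbf{B}^n\mathbb{R}_{\mathrm{conn}}$$ that commute with the inclusions of the $\mathrm{conn}$ objects into the $\mathrm{diff}$ objects. 4. Say that a form $\alpha$ on $U\times\Delta^k$ has *sitting instants* if, for every $u\in U$, its restriction to $\{u\}\times\Delta^k$ agrees, near every point $q\in\Delta^k$, with the pullback of itself along the orthogonal projection (for the metric in which the simplex is regular) to the affine span of the smallest face containing $q$. The $n$-forms with sitting instants are stable under smooth base change $U\to V$ and under all face maps. -/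

import Mathlib

open CategoryTheory Opposite
open scoped ContDiff Topology

noncomputable section

namespace FiberIntegration

/-! ### Smooth differential forms on convex bodies -/

section Forms

variable {W W' W'' : Type} [NormedAddCommGroup W] [NormedSpace ℝ W]
  [NormedAddCommGroup W'] [NormedSpace ℝ W'] [NormedAddCommGroup W''] [NormedSpace ℝ W'']

/-- A convex set with nonempty interior; all spaces below (`ℝ^m`, and `ℝ^m × Δ^k` inside
`ℝ^m × ℝ^k`) are of this kind. -/
structure IsBody (S : Set W) : Prop where
  convex : Convex ℝ S
  nonempty : (interior S).Nonempty

theorem IsBody.uniqueDiffOn {S : Set W} (hS : IsBody S) : UniqueDiffOn ℝ S :=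
  uniqueDiffOn_convex hS.convex hS.nonempty

theorem IsBody.subset_closure {S : Set W} (hS : IsBody S) : S ⊆ closure (interior S) := by
  rw [hS.convex.closure_interior_eq_closure_of_nonempty_interior hS.nonempty]
  exact _root_.subset_closure

theorem isBody_univ : IsBody (Set.univ : Set W) :=
  ⟨convex_univ, by simp⟩

theorem minSmoothness_two_le : minSmoothness ℝ 2 ≤ (∞ : WithTop ℕ∞) := by
  rw [minSmoothness_of_isRCLikeNormedField]
  exact WithTop.coe_le_coe.2 le_top

/-- Smooth differential `n`-forms on `S` (smooth up to the boundary). A form is stored as a function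
on the whole vector space that vanishes off `S`, so that two forms are equal exactly if they agree
on `S`. -/
def formSubmodule (S : Set W) (n : ℕ) : Submodule ℝ (W → W [⋀^Fin n]→L[ℝ] ℝ) where
  carrier := {α | ContDiffOn ℝ ∞ α S ∧ ∀ x ∉ S, α x = 0}
  add_mem' := by
    rintro a b ⟨ha, ha'⟩ ⟨hb, hb'⟩
    exact ⟨ha.add hb, fun x hx => by simp [ha' x hx, hb' x hx]⟩
  zero_mem' := ⟨contDiffOn_const, fun _ _ => rfl⟩
  smul_mem' := by
    rintro c a ⟨ha, ha'⟩
    exact ⟨contDiffOn_const.smul ha, fun x hx => by simp [ha' x hx]⟩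

/-- The real vector space `Ω^n(S)` of smooth `n`-forms on `S`. -/
def Form (S : Set W) (n : ℕ) : Type := formSubmodule S n

instance (S : Set W) (n : ℕ) : AddCommGroup (Form S n) :=
  inferInstanceAs (AddCommGroup (formSubmodule S n))

instance (S : Set W) (n : ℕ) : Module ℝ (Form S n) :=
  inferInstanceAs (Module ℝ (formSubmodule S n))

/-- The form with a given underlying function. -/
def Form.of {S : Set W} {n : ℕ} (f : W → W [⋀^Fin n]→L[ℝ] ℝ) (h : ContDiffOn ℝ ∞ f S)
    (h' : ∀ x ∉ S, f x = 0) : Form S n := ⟨f, h, h'⟩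

@[simp] theorem Form.of_val {S : Set W} {n : ℕ} (f : W → W [⋀^Fin n]→L[ℝ] ℝ)
    (h : ContDiffOn ℝ ∞ f S) (h' : ∀ x ∉ S, f x = 0) : (Form.of f h h').1 = f := rfl

@[simp] theorem Form.add_val {S : Set W} {n : ℕ} (α β : Form S n) : (α + β).1 = α.1 + β.1 := rfl

@[simp] theorem Form.smul_val {S : Set W} {n : ℕ} (c : ℝ) (α : Form S n) :
    (c • α).1 = c • α.1 := rfl

@[simp] theorem Form.zero_val {S : Set W} {n : ℕ} : (0 : Form S n).1 = 0 := rfl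

theorem Form.ext {S : Set W} {n : ℕ} {α η : Form S n} (h : ∀ x ∈ S, α.1 x = η.1 x) : α = η := by
  apply Subtype.ext
  funext x
  by_cases hx : x ∈ S
  · exact h x hx
  · rw [α.2.2 x hx, η.2.2 x hx]

open scoped Classical in
/-- The exterior derivative of a form. -/
def extD {S : Set W} (hS : IsBody S) (n : ℕ) : Form S n →ₗ[ℝ] Form S (n + 1) where
  toFun α := Form.of (fun x => if x ∈ S then extDerivWithin α.1 S x else 0) (by
    have h : ContDiffOn ℝ ∞ (extDerivWithin α.1 S) S :=
      (ContinuousAlternatingMap.alternatizeUncurryFinCLM ℝ W ℝ).contDiff.comp_contDiffOn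
        (α.2.1.fderivWithin hS.uniqueDiffOn (by simp))
    exact h.congr fun x hx => by simp [hx]) (fun x hx => by simp [hx])
  map_add' α η := by
    apply Form.ext
    intro x hx
    have h1 := (α.2.1.differentiableOn (by simp)) x hx
    have h2 := (η.2.1.differentiableOn (by simp)) x hx
    simpa [hx] using extDerivWithin_add (hS.uniqueDiffOn x hx) h1 h2
  map_smul' c α := by
    apply Form.ext
    intro x hx
    simpa [hx] using extDerivWithin_smul c α.1 (hS.uniqueDiffOn x hx)

theorem extD_apply {S : Set W} (hS : IsBody S) {n : ℕ} (α : Form S n) {x : W} (hx : x ∈ S) :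
    (extD hS n α).1 x = extDerivWithin α.1 S x := by
  simp [extD, hx]

theorem extD_extD {S : Set W} (hS : IsBody S) {n : ℕ} (α : Form S n) :
    extD hS (n + 1) (extD hS n α) = 0 := by
  apply Form.ext
  intro x hx
  rw [extD_apply hS _ hx]
  have h : extDerivWithin (extD hS n α).1 S x = extDerivWithin (extDerivWithin α.1 S) S x :=
    extDerivWithin_congr (fun y hy => extD_apply hS α hy) (extD_apply hS α hx)
  rw [h]
  exact extDerivWithin_extDerivWithin_eqOn α.2.1 minSmoothness_two_le hS.uniqueDiffOn
    ⟨hx, hS.subset_closure hx⟩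

/-- Pulling back alternating forms along linear maps is smooth in both arguments. -/
theorem contDiff_compContinuousLinearMap (n : ℕ) :
    ContDiff ℝ ∞ (fun q : (W [⋀^Fin n]→L[ℝ] ℝ) × (W' →L[ℝ] W) =>
      q.1.compContinuousLinearMap q.2) := by
  let A : ContinuousMultilinearMap ℝ (fun _ : Fin n => W') ℝ →L[ℝ] W' [⋀^Fin n]→L[ℝ] ℝ :=
    LinearMap.mkContinuous
      { toFun := fun f => ((n.factorial : ℝ)⁻¹) • ContinuousMultilinearMap.alternatization f
        map_add' := fun f g => by simp
        map_smul' := fun c f => by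
          ext v
          have h : ContinuousMultilinearMap.alternatization (c • f) v =
              c * ContinuousMultilinearMap.alternatization f v := by
            rw [ContinuousMultilinearMap.alternatization_apply_apply,
              ContinuousMultilinearMap.alternatization_apply_apply, Finset.mul_sum]
            refine Finset.sum_congr rfl fun σ _ => ?_
            rcases Int.units_eq_one_or (Equiv.Perm.sign σ) with h | h <;> rw [h] <;> simp
          change (n.factorial : ℝ)⁻¹ * ContinuousMultilinearMap.alternatization (c • f) v =
            c * ((n.factorial : ℝ)⁻¹ * ContinuousMultilinearMap.alternatization f v)
          rw [h]
          ring }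
      1 (fun f => by
        refine ContinuousAlternatingMap.opNorm_le_bound _ (by positivity) fun v => ?_
        simp only [LinearMap.coe_mk, AddHom.coe_mk, ContinuousAlternatingMap.smul_apply,
          ContinuousMultilinearMap.alternatization_apply_apply, one_mul]
        rw [norm_smul, norm_inv, Real.norm_natCast]
        have h : ‖∑ σ : Equiv.Perm (Fin n), Equiv.Perm.sign σ • f (v ∘ σ)‖ ≤
            n.factorial * (‖f‖ * ∏ i, ‖v i‖) := by
          calc _ ≤ ∑ σ : Equiv.Perm (Fin n), ‖Equiv.Perm.sign σ • f (v ∘ σ)‖ := norm_sum_le _ _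
            _ ≤ ∑ σ : Equiv.Perm (Fin n), (‖f‖ * ∏ i, ‖v i‖) := by
              refine Finset.sum_le_sum fun σ _ => ?_
              have h1 : ‖Equiv.Perm.sign σ • f (v ∘ σ)‖ = ‖f (v ∘ σ)‖ := by
                rcases Int.units_eq_one_or (Equiv.Perm.sign σ) with h | h <;> rw [h] <;> simp
              rw [h1]
              refine (f.le_opNorm _).trans_eq ?_
              congr 1
              exact Equiv.prod_comp σ fun i => ‖v i‖
            _ = _ := by simp [Fintype.card_perm]
        have hn : (0 : ℝ) < n.factorial := by positivity
        rw [inv_mul_le_iff₀ hn]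
        exact h)
  have hA : ∀ f : W' [⋀^Fin n]→L[ℝ] ℝ, A f.toContinuousMultilinearMap = f := by
    intro f
    ext v
    have hn : (n.factorial : ℝ) ≠ 0 := by positivity
    simp only [A, LinearMap.mkContinuous_apply, LinearMap.coe_mk, AddHom.coe_mk,
      ContinuousAlternatingMap.smul_apply, ContinuousMultilinearMap.alternatization_apply_apply]
    have h1 : ∀ σ : Equiv.Perm (Fin n),
        Equiv.Perm.sign σ • f.toContinuousMultilinearMap (v ∘ σ) = f v := by
      intro σ
      have h2 : f (v ∘ σ) = Equiv.Perm.sign σ • f v := f.toAlternatingMap.map_perm v σ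
      change Equiv.Perm.sign σ • f (v ∘ σ) = f v
      rw [h2, smul_smul, Int.units_mul_self, one_smul]
    rw [Finset.sum_congr rfl fun σ _ => h1 σ]
    simp [Fintype.card_perm, hn]
  have hM : ContDiff ℝ ∞ (fun q : (W [⋀^Fin n]→L[ℝ] ℝ) × (W' →L[ℝ] W) =>
      ContinuousMultilinearMap.compContinuousLinearMapContinuousMultilinear ℝ
        (fun _ : Fin n => W') (fun _ => W) ℝ (fun _ => q.2)
        (ContinuousAlternatingMap.toContinuousMultilinearMapCLM ℝ q.1)) := by
    refine ContDiff.clm_apply ?_ ?_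
    · exact (ContinuousMultilinearMap.contDiff _).comp (contDiff_pi.2 fun _ => contDiff_snd)
    · exact (ContinuousLinearMap.contDiff _).comp contDiff_fst
  have h := A.contDiff.comp hM
  have he : (fun q : (W [⋀^Fin n]→L[ℝ] ℝ) × (W' →L[ℝ] W) => q.1.compContinuousLinearMap q.2) =
      A ∘ (fun q : (W [⋀^Fin n]→L[ℝ] ℝ) × (W' →L[ℝ] W) =>
      ContinuousMultilinearMap.compContinuousLinearMapContinuousMultilinear ℝ
        (fun _ : Fin n => W') (fun _ => W) ℝ (fun _ => q.2)
        (ContinuousAlternatingMap.toContinuousMultilinearMapCLM ℝ q.1)) :=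
    funext fun q => (hA _).symm
  rw [he]
  exact h

open scoped Classical in
/-- The pullback of forms along a smooth map. -/
def pullback {S : Set W} {S' : Set W'} (F : W' → W) (hF : ContDiff ℝ ∞ F)
    (hm : Set.MapsTo F S' S) (n : ℕ) : Form S n →ₗ[ℝ] Form S' n where
  toFun α := Form.of
    (fun x => if x ∈ S' then (α.1 (F x)).compContinuousLinearMap (fderiv ℝ F x) else 0) (by
    have h : ContDiffOn ℝ ∞ (fun x => (α.1 (F x)).compContinuousLinearMap (fderiv ℝ F x)) S' :=
      (contDiff_compContinuousLinearMap n).comp_contDiffOn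
        ((α.2.1.comp hF.contDiffOn hm).prodMk (hF.fderiv_right (by simp)).contDiffOn)
    exact h.congr fun x hx => by simp [hx]) (fun x hx => by simp [hx])
  map_add' α η := by
    apply Form.ext
    intro x hx
    ext v
    simp [hx]
  map_smul' c α := by
    apply Form.ext
    intro x hx
    ext v
    simp [hx]

theorem pullback_apply {S : Set W} {S' : Set W'} (F : W' → W) (hF : ContDiff ℝ ∞ F)
    (hm : Set.MapsTo F S' S) {n : ℕ} (α : Form S n) {x : W'} (hx : x ∈ S') :
    (pullback F hF hm n α).1 x = (α.1 (F x)).compContinuousLinearMap (fderiv ℝ F x) := by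
  simp [pullback, hx]

theorem pullback_id {S : Set W} (F : W → W) (hF : ContDiff ℝ ∞ F) (hm : Set.MapsTo F S S)
    (h : F = id) {n : ℕ} (α : Form S n) : pullback F hF hm n α = α := by
  subst h
  apply Form.ext
  intro x hx
  rw [pullback_apply _ _ _ _ hx]
  ext v
  simp

theorem pullback_comp {S : Set W} {S' : Set W'} {S'' : Set W''}
    (F : W' → W) (hF : ContDiff ℝ ∞ F) (hm : Set.MapsTo F S' S)
    (G : W'' → W') (hG : ContDiff ℝ ∞ G) (hm' : Set.MapsTo G S'' S')
    (H : W'' → W) (hH : ContDiff ℝ ∞ H) (hm'' : Set.MapsTo H S'' S) (h : H = F ∘ G)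
    {n : ℕ} (α : Form S n) :
    pullback H hH hm'' n α = pullback G hG hm' n (pullback F hF hm n α) := by
  subst h
  apply Form.ext
  intro x hx
  rw [pullback_apply _ _ _ _ hx, pullback_apply _ _ _ _ hx, pullback_apply _ _ _ _ (hm' hx),
    fderiv_comp x (hF.differentiable (by simp) _) (hG.differentiable (by simp) _)]
  rfl

theorem extD_pullback {S : Set W} {S' : Set W'} (hS : IsBody S) (hS' : IsBody S')
    (F : W' → W) (hF : ContDiff ℝ ∞ F) (hm : Set.MapsTo F S' S) {n : ℕ} (α : Form S n) :
    extD hS' n (pullback F hF hm n α) = pullback F hF hm (n + 1) (extD hS n α) := by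
  apply Form.ext
  intro x hx
  rw [extD_apply hS' _ hx, pullback_apply _ _ _ _ hx, extD_apply hS _ (hm hx)]
  have hfd : ∀ y ∈ S', fderiv ℝ F y = fderivWithin ℝ F S' y := fun y hy =>
    ((hF.differentiable (by simp) y).fderivWithin (hS'.uniqueDiffOn y hy)).symm
  have h : Set.EqOn (pullback F hF hm n α).1
      (fun x => (α.1 (F x)).compContinuousLinearMap (fderivWithin ℝ F S' x)) S' := by
    intro y hy
    rw [pullback_apply _ _ _ _ hy, hfd y hy]
  rw [extDerivWithin_congr h (h hx), hfd x hx]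
  exact extDerivWithin_pullback (r := ∞) ((α.2.1.differentiableOn (by simp)) _ (hm hx))
    hF.contDiffAt.contDiffWithinAt minSmoothness_two_le hS'.uniqueDiffOn (hS'.subset_closure hx) hx hm

end Forms

/-! ### Cartesian spaces -/

/-- A Cartesian space `ℝ^m`, given by its dimension. -/
structure CartSp : Type where
  dim : ℕ

/-- The vector space `ℝ^m`. -/
abbrev CartSp.Space (U : CartSp) : Type := Fin U.dim → ℝ

/-- Cartesian spaces and smooth maps between them. -/
instance : Category.{0} CartSp where
  Hom U V := {f : U.Space → V.Space // ContDiff ℝ ∞ f}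
  id _ := ⟨id, contDiff_id⟩
  comp f g := ⟨g.1 ∘ f.1, g.2.comp f.2⟩

/-- Presheaves of real vector spaces on the site of Cartesian spaces. -/
abbrev Psh : Type 1 := CartSpᵒᵖ ⥤ ModuleCat.{0} ℝ

/-- The vector space `Ω^p(U)`. -/
abbrev Omega (p : ℕ) (U : CartSp) : Type :=
  Form (Set.univ : Set U.Space) p

/-- The de Rham differential `Ω^p(U) → Ω^(p+1)(U)`. -/
abbrev dR (p : ℕ) (U : CartSp) : Omega p U →ₗ[ℝ] Omega (p + 1) U := extD isBody_univ p

/-- The pullback of forms along a smooth map of Cartesian spaces. -/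
abbrev pullU (p : ℕ) {U V : CartSp} (f : U ⟶ V) : Omega p V →ₗ[ℝ] Omega p U :=
  pullback f.1 f.2 (Set.mapsTo_univ _ _) p

/-! ### The standard simplex -/

/-- The barycentric coordinates `(1 - t₁ - ⋯ - t_k, t₁, …, t_k)` of a point of `ℝ^k`. -/
def bary {k : ℕ} (t : Fin k → ℝ) : Fin (k + 1) → ℝ := Fin.cons (1 - ∑ i, t i) t

/-- The standard simplex `Δ^k = {t ∈ ℝ^k | t_i ≥ 0, t₁ + ⋯ + t_k ≤ 1}`; its vertices are, in order,
`0, e₁, …, e_k`. -/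
def simplex (k : ℕ) : Set (Fin k → ℝ) := {t | (∀ i, 0 ≤ t i) ∧ ∑ i, t i ≤ 1}

/-- The affine map `ℝ^k → ℝ^l` that maps the vertices of `Δ^k` to those of `Δ^l` as prescribed. -/
def simplexMap {k l : ℕ} (θ : Fin (k + 1) → Fin (l + 1)) (t : Fin k → ℝ) : Fin l → ℝ :=
  fun j => ∑ i with θ i = j.succ, bary t i

theorem sum_bary {k : ℕ} (t : Fin k → ℝ) : ∑ i, bary t i = 1 := by
  simp [bary, Fin.sum_univ_succ]

theorem mem_simplex_iff {k : ℕ} (t : Fin k → ℝ) : t ∈ simplex k ↔ ∀ i, 0 ≤ bary t i := by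
  rw [Fin.forall_fin_succ]
  simp [simplex, bary, and_comm]

theorem bary_simplexMap {k l : ℕ} (θ : Fin (k + 1) → Fin (l + 1)) (t : Fin k → ℝ)
    (j : Fin (l + 1)) : bary (simplexMap θ t) j = ∑ i with θ i = j, bary t i := by
  induction j using Fin.cases with
  | zero =>
    have h : ∑ j, ∑ i with θ i = j, bary t i = 1 := by
      rw [Finset.sum_fiberwise]; exact sum_bary t
    rw [Fin.sum_univ_succ] at h
    simp only [bary, Fin.cons_zero] at h ⊢
    simp only [simplexMap, bary]
    linarith
  | succ j => simp [bary, simplexMap]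

theorem simplexMap_mapsTo {k l : ℕ} (θ : Fin (k + 1) → Fin (l + 1)) :
    Set.MapsTo (simplexMap θ) (simplex k) (simplex l) := by
  intro t ht
  rw [mem_simplex_iff] at ht ⊢
  intro j
  rw [bary_simplexMap]
  exact Finset.sum_nonneg fun i _ => ht i

theorem bary_injective {k : ℕ} {s t : Fin k → ℝ} (h : bary s = bary t) : s = t := by
  funext i
  simpa [bary] using congrFun h i.succ

theorem simplexMap_id {k : ℕ} : simplexMap (id : Fin (k + 1) → Fin (k + 1)) = id := by
  funext t
  apply bary_injective
  funext j
  rw [bary_simplexMap]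
  simp [Finset.filter_eq']

theorem simplexMap_comp {k l m : ℕ} (θ : Fin (k + 1) → Fin (l + 1))
    (η : Fin (l + 1) → Fin (m + 1)) :
    simplexMap (η ∘ θ) = simplexMap η ∘ simplexMap θ := by
  funext t
  apply bary_injective
  funext j
  simp only [Function.comp_apply, bary_simplexMap]
  rw [← Finset.sum_fiberwise_of_maps_to (g := θ) (t := Finset.univ.filter fun i => η i = j)
    (by simp)]
  refine Finset.sum_congr rfl fun i hi => Finset.sum_congr ?_ fun _ _ => rfl
  ext a
  simp only [Finset.mem_filter, Finset.mem_univ, true_and] at hi ⊢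
  constructor
  · exact fun h => h.2
  · rintro rfl
    exact ⟨hi, rfl⟩

theorem contDiff_bary {k : ℕ} (i : Fin (k + 1)) :
    ContDiff ℝ ∞ (fun t : Fin k → ℝ => bary t i) := by
  induction i using Fin.cases with
  | zero => simp only [bary, Fin.cons_zero]; fun_prop
  | succ i => simp only [bary, Fin.cons_succ]; fun_prop

theorem contDiff_simplexMap {k l : ℕ} (θ : Fin (k + 1) → Fin (l + 1)) :
    ContDiff ℝ ∞ (simplexMap θ) :=
  contDiff_pi.2 fun _ => ContDiff.sum fun i _ => contDiff_bary i

/-- The trivial simplex bundle `ℝ^m × Δ^k`, as a subset of `ℝ^m × ℝ^k`. -/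
def tube (U : CartSp) (k : ℕ) : Set (U.Space × (Fin k → ℝ)) := Set.univ ×ˢ simplex k

theorem isBody_tube (U : CartSp) (k : ℕ) : IsBody (tube U k) := by
  constructor
  · refine convex_univ.prod ?_
    rintro s ⟨hs, hs'⟩ t ⟨ht, ht'⟩ a b ha hb hab
    refine ⟨fun i => ?_, ?_⟩
    · have := hs i
      have := ht i
      simp only [Pi.add_apply, Pi.smul_apply, smul_eq_mul]
      positivity
    · simp only [Pi.add_apply, Pi.smul_apply, smul_eq_mul, Finset.sum_add_distrib,
        ← Finset.mul_sum]
      nlinarith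
  · let O : Set (Fin k → ℝ) := (⋂ i, (fun t => t i) ⁻¹' Set.Ioi 0) ∩ (fun t => ∑ i, t i) ⁻¹' Set.Iio 1
    have hopen : IsOpen O := by
      apply IsOpen.inter
      · exact isOpen_iInter_of_finite fun i => isOpen_Ioi.preimage (continuous_apply i)
      · exact isOpen_Iio.preimage (by fun_prop)
    have hsub : O ⊆ interior (simplex k) :=
      interior_maximal (fun t ht => ⟨fun i => (Set.mem_iInter.1 ht.1 i).le, ht.2.le⟩) hopen
    refine ⟨(0, fun _ => 1 / ((k : ℝ) + 1)), ?_⟩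
    rw [tube, interior_prod_eq, interior_univ]
    refine ⟨Set.mem_univ _, hsub ⟨Set.mem_iInter.2 fun i => ?_, ?_⟩⟩
    · change (0 : ℝ) < 1 / ((k : ℝ) + 1)
      positivity
    change ∑ _i : Fin k, 1 / ((k : ℝ) + 1) < 1
    simp only [Finset.sum_const, Finset.card_univ, Fintype.card_fin, nsmul_eq_mul]
    rw [mul_one_div, div_lt_one (by positivity)]
    linarith

/-! ### Forms on the simplex bundles -/

theorem tube_mapsTo {U V : CartSp} (f : U ⟶ V) {k l : ℕ} (θ : Fin (k + 1) → Fin (l + 1)) :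
    Set.MapsTo (Prod.map f.1 (simplexMap θ)) (tube U k) (tube V l) :=
  fun _ hx => Set.mk_mem_prod (Set.mem_univ _) (simplexMap_mapsTo θ hx.2)

/-- The pullback of `n`-forms along `f × θ : U × Δ^a → V × Δ^b`. -/
def cellMap (n : ℕ) {U V : CartSp} (f : U ⟶ V) {a b : SimplexCategory} (θ : a ⟶ b) :
    Form (tube V b.len) n →ₗ[ℝ] Form (tube U a.len) n :=
  pullback (Prod.map f.1 (simplexMap θ.toOrderHom))
    (f.2.prodMap (contDiff_simplexMap _))
    (tube_mapsTo f _) n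

theorem cellMap_id (n : ℕ) (U : CartSp) (a : SimplexCategory) (α : Form (tube U a.len) n) :
    cellMap n (𝟙 U) (𝟙 a) α = α := by
  refine pullback_id _ _ _ ?_ α
  have h : simplexMap (⇑(SimplexCategory.Hom.toOrderHom (𝟙 a))) = id := by
    rw [SimplexCategory.id_toOrderHom]
    exact simplexMap_id
  rw [h]
  rfl

theorem cellMap_comp (n : ℕ) {U V X : CartSp} (f : U ⟶ V) (g : V ⟶ X) {a b c : SimplexCategory}
    (θ : a ⟶ b) (η : b ⟶ c) (α : Form (tube X c.len) n) :
    cellMap n (f ≫ g) (θ ≫ η) α = cellMap n f θ (cellMap n g η α) := by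
  refine pullback_comp _ _ _ _ _ _ _ _ _ ?_ α
  have h : simplexMap (⇑(SimplexCategory.Hom.toOrderHom (θ ≫ η))) =
      simplexMap η.toOrderHom ∘ simplexMap θ.toOrderHom := by
    rw [← simplexMap_comp, SimplexCategory.comp_toOrderHom]
    rfl
  rw [h]
  rfl

theorem fderiv_cellMap {U V : CartSp} (f : U ⟶ V) {k l : ℕ} (θ : Fin (k + 1) → Fin (l + 1))
    (x : U.Space × (Fin k → ℝ)) :
    fderiv ℝ (Prod.map f.1 (simplexMap θ)) x =
      (fderiv ℝ f.1 x.1).prodMap (fderiv ℝ (simplexMap θ) x.2) :=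
  (HasFDerivAt.prodMap x (f.2.differentiable (by simp) _).hasFDerivAt
    ((contDiff_simplexMap θ).differentiable (by simp) _).hasFDerivAt).fderiv

/-- A family of spaces of `n`-forms on the simplex bundles `U × Δ^k` that is stable under pullback
along all smooth maps of the base and all simplicial maps of the fibre. -/
structure CellFamily (n : ℕ) where
  cells : ∀ (U : CartSp) (k : ℕ), Submodule ℝ (Form (tube U k) n)
  stable : ∀ {U V : CartSp} (f : U ⟶ V) {a b : SimplexCategory} (θ : a ⟶ b)
    (α : Form (tube V b.len) n), α ∈ cells V b.len → cellMap n f θ α ∈ cells U a.len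

/-- The pullback maps of a stable family. -/
def CellFamily.map {n : ℕ} (C : CellFamily n) {U V : CartSp} (f : U ⟶ V) {a b : SimplexCategory}
    (θ : a ⟶ b) : C.cells V b.len →ₗ[ℝ] C.cells U a.len :=
  (cellMap n f θ).restrict (C.stable f θ)

theorem CellFamily.map_id {n : ℕ} (C : CellFamily n) (U : CartSp) (a : SimplexCategory)
    (α : C.cells U a.len) : C.map (𝟙 U) (𝟙 a) α = α :=
  Subtype.ext (cellMap_id n U a α.1)

theorem CellFamily.map_comp {n : ℕ} (C : CellFamily n) {U V X : CartSp} (f : U ⟶ V) (g : V ⟶ X)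
    {a b c : SimplexCategory} (θ : a ⟶ b) (η : b ⟶ c) (α : C.cells X c.len) :
    C.map (f ≫ g) (θ ≫ η) α = C.map f θ (C.map g η α) :=
  Subtype.ext (cellMap_comp n f g θ η α.1)

/-- The simplicial presheaf `(U, [k]) ↦ cells U k` of a stable family. -/
def CellFamily.presheaf {n : ℕ} (C : CellFamily n) : SimplicialObject Psh where
  obj a :=
    { obj := fun U => ModuleCat.of ℝ ↥(C.cells U.unop a.unop.len)
      map := fun f => ModuleCat.ofHom (C.map f.unop (𝟙 a.unop))
      map_id := fun U => by
        refine ModuleCat.hom_ext (LinearMap.ext fun α => ?_)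
        exact C.map_id U.unop a.unop α
      map_comp := fun f g => by
        refine ModuleCat.hom_ext (LinearMap.ext fun α => ?_)
        have h := C.map_comp g.unop f.unop (𝟙 a.unop) (𝟙 a.unop) α
        rw [Category.comp_id] at h
        exact h }
  map θ :=
    { app := fun U => ModuleCat.ofHom (C.map (𝟙 U.unop) θ.unop)
      naturality := fun U V f => by
        refine ModuleCat.hom_ext (LinearMap.ext fun α => ?_)
        have h1 := C.map_comp (𝟙 V.unop) f.unop θ.unop (𝟙 _) α
        have h2 := C.map_comp f.unop (𝟙 U.unop) (𝟙 _) θ.unop α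
        rw [Category.comp_id, Category.id_comp] at h1 h2
        exact h1.symm.trans h2 }
  map_id a := by
    refine NatTrans.ext (funext fun U => ModuleCat.hom_ext (LinearMap.ext fun α => ?_))
    exact C.map_id U.unop a.unop α
  map_comp θ η := by
    refine NatTrans.ext (funext fun U => ModuleCat.hom_ext (LinearMap.ext fun α => ?_))
    have h := C.map_comp (𝟙 U.unop) (𝟙 U.unop) η.unop θ.unop α
    rw [Category.comp_id] at h
    exact h

/-- The inclusion of simplicial presheaves given by an inclusion of stable families. -/
def CellFamily.inclusion {n : ℕ} {C D : CellFamily n} (h : ∀ U k, C.cells U k ≤ D.cells U k) :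
    C.presheaf ⟶ D.presheaf where
  app a :=
    { app := fun U => ModuleCat.ofHom (Submodule.inclusion (h U.unop a.unop.len))
      naturality := fun _ _ _ => rfl }
  naturality _ _ _ := rfl

/-- The cells of `exp_Δ(b^(n-1)ℝ)_diff`: the `n`-forms `α` on `U × Δ^k` whose curvature `dα` vanishes
when all its arguments are tangent to the simplex. -/
def diffFamily (n : ℕ) : CellFamily n where
  cells U k :=
    { carrier := {α | ∀ x ∈ tube U k, ∀ v : Fin (n + 1) → (Fin k → ℝ),
        (extD (isBody_tube U k) n α).1 x (fun i => ((0 : U.Space), v i)) = 0}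
      add_mem' := fun {α β} hα hβ x hx v => by
        simp [hα x hx v, hβ x hx v]
      zero_mem' := fun x hx v => by simp
      smul_mem' := fun c α hα x hx v => by
        simp [hα x hx v] }
  stable {U V} f {a b} θ α hα := by
    intro x hx v
    rw [cellMap, extD_pullback (isBody_tube V b.len), pullback_apply _ _ _ _ hx, fderiv_cellMap]
    have h := hα (Prod.map f.1 (simplexMap θ.toOrderHom) x)
      (tube_mapsTo f _ hx)
      (fun i => fderiv ℝ (simplexMap θ.toOrderHom) x.2 (v i))
    rw [← h]
    simp [Function.comp_def]

/-- The cells of `exp_Δ(b^(n-1)ℝ)_conn`: the cells of `exp_Δ(b^(n-1)ℝ)_diff` for which the contraction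
of the curvature `dα` with every vector tangent to the simplex vanishes. -/
def connFamily (n : ℕ) : CellFamily n where
  cells U k :=
    { carrier := {α | α ∈ (diffFamily n).cells U k ∧
        ∀ x ∈ tube U k, ∀ (v : Fin k → ℝ) (w : Fin n → U.Space × (Fin k → ℝ)),
          (extD (isBody_tube U k) n α).1 x (Fin.cons ((0 : U.Space), v) w) = 0}
      add_mem' := fun {α β} hα hβ => ⟨add_mem hα.1 hβ.1, fun x hx v w => by
        simp [hα.2 x hx v w, hβ.2 x hx v w]⟩
      zero_mem' := ⟨zero_mem _, fun x hx v w => by simp⟩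
      smul_mem' := fun c α hα => ⟨Submodule.smul_mem _ c hα.1, fun x hx v w => by
        simp [hα.2 x hx v w]⟩ }
  stable {U V} f {a b} θ α hα := by
    refine ⟨(diffFamily n).stable f θ α hα.1, ?_⟩
    intro x hx v w
    rw [cellMap, extD_pullback (isBody_tube V b.len), pullback_apply _ _ _ _ hx, fderiv_cellMap]
    have h := hα.2 (Prod.map f.1 (simplexMap θ.toOrderHom) x)
      (tube_mapsTo f _ hx)
      (fderiv ℝ (simplexMap θ.toOrderHom) x.2 v)
      (fun i => ((fderiv ℝ f.1 x.1).prodMap (fderiv ℝ (simplexMap θ.toOrderHom) x.2)) (w i))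
    rw [← h, ContinuousAlternatingMap.compContinuousLinearMap_apply]
    congr 1
    funext i
    induction i using Fin.cases with
    | zero => simp
    | succ i => simp

/-- The simplicial presheaf `exp_Δ(b^(n-1)ℝ)_diff`. -/
def expDiff (n : ℕ) : SimplicialObject Psh := (diffFamily n).presheaf

/-- The simplicial presheaf `exp_Δ(b^(n-1)ℝ)_conn`. -/
def expConn (n : ℕ) : SimplicialObject Psh := (connFamily n).presheaf

/-- The inclusion of `exp_Δ(b^(n-1)ℝ)_conn` into `exp_Δ(b^(n-1)ℝ)_diff`. -/
def expInclusion (n : ℕ) : expConn n ⟶ expDiff n :=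
  CellFamily.inclusion fun _ _ _ hα => hα.1

/-! ### The Deligne complex and the cone complex -/

/-- Degree `k` of the complex `Ω^0 → Ω^1 → ⋯ → Ω^n` with `Ω^n` in degree `0`: this is `Ω^p(U)` with
`p + k = n`, and zero for `k > n`. -/
abbrev UpRow (n k : ℕ) (U : CartSp) : Type := ∀ p : {p : ℕ // p + k = n}, Omega p.1 U

/-- Degree `k` of the complex `Ω^1 → ⋯ → Ω^n → 0` with `Ω^n` in degree `1`: this is `Ω^(p+1)(U)` with
`p + k = n` for `k ≥ 1`, and zero for `k = 0` and for `k > n`. -/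
abbrev LowRow (n k : ℕ) (U : CartSp) : Type :=
  ∀ p : {p : ℕ // p + k = n ∧ 1 ≤ k}, Omega (p.1 + 1) U

/-- The de Rham differential of the first row. -/
def dUp (n k : ℕ) (U : CartSp) : UpRow n (k + 1) U →ₗ[ℝ] UpRow n k U :=
  LinearMap.pi fun p => match p with
    | ⟨0, _⟩ => 0
    | ⟨p + 1, h⟩ => dR p U ∘ₗ
        LinearMap.proj (R := ℝ) (φ := fun q : {p : ℕ // p + (k + 1) = n} => Omega q.1 U)
          ⟨p, by omega⟩

/-- The de Rham differential of the second row. -/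
def dLow (n k : ℕ) (U : CartSp) : LowRow n (k + 1) U →ₗ[ℝ] LowRow n k U :=
  LinearMap.pi fun p => match p with
    | ⟨0, _⟩ => 0
    | ⟨p + 1, h⟩ => dR (p + 1) U ∘ₗ
        LinearMap.proj (R := ℝ)
          (φ := fun q : {p : ℕ // p + (k + 1) = n ∧ 1 ≤ k + 1} => Omega (q.1 + 1) U)
          ⟨p, by omega⟩

/-- The inclusion of the second row, shifted by one degree, into the first row. -/
def lowToUp (n k : ℕ) (U : CartSp) : LowRow n (k + 1) U →ₗ[ℝ] UpRow n k U :=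
  LinearMap.pi fun p => match p with
    | ⟨0, _⟩ => 0
    | ⟨p + 1, h⟩ =>
        LinearMap.proj (R := ℝ)
          (φ := fun q : {p : ℕ // p + (k + 1) = n ∧ 1 ≤ k + 1} => Omega (q.1 + 1) U)
          ⟨p, by omega⟩

/-- Pullback in the first row. -/
def pullUp (n k : ℕ) {U V : CartSp} (f : U ⟶ V) : UpRow n k V →ₗ[ℝ] UpRow n k U :=
  LinearMap.pi fun p => pullU p.1 f ∘ₗ LinearMap.proj p

/-- Pullback in the second row. -/
def pullLow (n k : ℕ) {U V : CartSp} (f : U ⟶ V) : LowRow n k V →ₗ[ℝ] LowRow n k U :=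
  LinearMap.pi fun p => pullU (p.1 + 1) f ∘ₗ LinearMap.proj p

theorem pullU_id (p : ℕ) (U : CartSp) (α : Omega p U) : pullU p (𝟙 U) α = α :=
  pullback_id _ _ _ rfl α

theorem pullU_comp (p : ℕ) {U V X : CartSp} (f : U ⟶ V) (g : V ⟶ X) (α : Omega p X) :
    pullU p (f ≫ g) α = pullU p f (pullU p g α) :=
  pullback_comp g.1 g.2 _ f.1 f.2 _ (f ≫ g).1 (f ≫ g).2 _ rfl α

theorem dR_pullU (p : ℕ) {U V : CartSp} (f : U ⟶ V) (α : Omega p V) :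
    dR p U (pullU p f α) = pullU (p + 1) f (dR p V α) :=
  extD_pullback _ _ _ _ _ α

theorem dUp_dUp (n k : ℕ) (U : CartSp) (a : UpRow n (k + 2) U) :
    dUp n k U (dUp n (k + 1) U a) = 0 := by
  funext ⟨p, h⟩
  match p, h with
  | 0, h => rfl
  | 1, h => exact map_zero (dR 0 U)
  | p + 2, h => exact extD_extD isBody_univ (a ⟨p, by omega⟩)

theorem dLow_dLow (n k : ℕ) (U : CartSp) (b : LowRow n (k + 2) U) :
    dLow n k U (dLow n (k + 1) U b) = 0 := by
  funext ⟨p, h⟩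
  match p, h with
  | 0, h => rfl
  | 1, h => exact map_zero (dR 1 U)
  | p + 2, h => exact extD_extD isBody_univ (b ⟨p, by omega⟩)

theorem dUp_lowToUp (n k : ℕ) (U : CartSp) (b : LowRow n (k + 2) U) :
    dUp n k U (lowToUp n (k + 1) U b) = lowToUp n k U (dLow n (k + 1) U b) := by
  funext ⟨p, h⟩
  match p, h with
  | 0, h => rfl
  | 1, h => exact map_zero (dR 0 U)
  | p + 2, h => rfl

theorem dUp_pullUp (n k : ℕ) {U V : CartSp} (f : U ⟶ V) (a : UpRow n (k + 1) V) :
    dUp n k U (pullUp n (k + 1) f a) = pullUp n k f (dUp n k V a) := by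
  funext ⟨p, h⟩
  match p, h with
  | 0, h => exact (map_zero (pullU 0 f)).symm
  | p + 1, h => exact dR_pullU p f _

theorem dLow_pullLow (n k : ℕ) {U V : CartSp} (f : U ⟶ V) (b : LowRow n (k + 1) V) :
    dLow n k U (pullLow n (k + 1) f b) = pullLow n k f (dLow n k V b) := by
  funext ⟨p, h⟩
  match p, h with
  | 0, h => exact (map_zero (pullU 1 f)).symm
  | p + 1, h => exact dR_pullU (p + 1) f _

theorem lowToUp_pullLow (n k : ℕ) {U V : CartSp} (f : U ⟶ V) (b : LowRow n (k + 1) V) :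
    lowToUp n k U (pullLow n (k + 1) f b) = pullUp n k f (lowToUp n k V b) := by
  funext ⟨p, h⟩
  match p, h with
  | 0, h => exact (map_zero (pullU 0 f)).symm
  | p + 1, h => rfl

/-- The presheaf `Ω^(n-k)`. -/
def deligneX (n k : ℕ) : Psh where
  obj U := ModuleCat.of ℝ (UpRow n k U.unop)
  map f := ModuleCat.ofHom (pullUp n k f.unop)
  map_id U := ModuleCat.hom_ext (LinearMap.ext fun a => funext fun p => pullU_id p.1 U.unop (a p))
  map_comp f g := ModuleCat.hom_ext (LinearMap.ext fun a => funext fun p =>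
    pullU_comp p.1 g.unop f.unop (a p))

/-- The presheaf `Ω^(n-k) ⊕ Ω^(n-k+1)` for `1 ≤ k ≤ n`, and `Ω^n` for `k = 0`. -/
def coneX (n k : ℕ) : Psh where
  obj U := ModuleCat.of ℝ (UpRow n k U.unop × LowRow n k U.unop)
  map f := ModuleCat.ofHom ((pullUp n k f.unop).prodMap (pullLow n k f.unop))
  map_id U := ModuleCat.hom_ext (LinearMap.ext fun a => Prod.ext
    (funext fun p => pullU_id p.1 U.unop (a.1 p))
    (funext fun p => pullU_id (p.1 + 1) U.unop (a.2 p)))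
  map_comp f g := ModuleCat.hom_ext (LinearMap.ext fun a => Prod.ext
    (funext fun p => pullU_comp p.1 g.unop f.unop (a.1 p))
    (funext fun p => pullU_comp (p.1 + 1) g.unop f.unop (a.2 p)))

/-- The differential `(a, b) ↦ (da + (-1)^k b, db)` from degree `k + 1` to degree `k`. -/
def dCone (n k : ℕ) (U : CartSp) :
    UpRow n (k + 1) U × LowRow n (k + 1) U →ₗ[ℝ] UpRow n k U × LowRow n k U :=
  (dUp n k U ∘ₗ LinearMap.fst ℝ _ _ + (-1 : ℝ) ^ k • (lowToUp n k U ∘ₗ LinearMap.snd ℝ _ _)).prod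
    (dLow n k U ∘ₗ LinearMap.snd ℝ _ _)

/-- The differential of the Deligne complex, as a morphism of presheaves. -/
def deligneD (n k : ℕ) : deligneX n (k + 1) ⟶ deligneX n k where
  app U := ModuleCat.ofHom (dUp n k U.unop)
  naturality _ _ f := ModuleCat.hom_ext (LinearMap.ext fun a => dUp_pullUp n k f.unop a)

/-- The differential of the cone complex, as a morphism of presheaves. -/
def coneD (n k : ℕ) : coneX n (k + 1) ⟶ coneX n k where
  app U := ModuleCat.ofHom (dCone n k U.unop)
  naturality U V f := ModuleCat.hom_ext (LinearMap.ext fun a => Prod.ext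
    (by
      change dUp n k _ (pullUp n (k + 1) f.unop a.1) +
          (-1 : ℝ) ^ k • lowToUp n k _ (pullLow n (k + 1) f.unop a.2) =
        pullUp n k f.unop (dUp n k _ a.1 + (-1 : ℝ) ^ k • lowToUp n k _ a.2)
      rw [dUp_pullUp, lowToUp_pullLow, map_add, map_smul])
    (dLow_pullLow n k f.unop a.2))

/-- The Deligne complex `C^∞ → Ω^1 → ⋯ → Ω^n` with `Ω^n` in degree `0`. -/
def deligne (n : ℕ) : ChainComplex Psh ℕ :=
  ChainComplex.of (deligneX n) (deligneD n)
    (fun k => NatTrans.ext (funext fun U => ModuleCat.hom_ext (LinearMap.ext fun a =>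
      dUp_dUp n k U.unop a)))

/-- The mapping cone of the inclusion of `Ω^1 → ⋯ → Ω^n` (the kernel of the projection of the Deligne
complex onto `C^∞` in degree `n`) into the Deligne complex. -/
def cone (n : ℕ) : ChainComplex Psh ℕ :=
  ChainComplex.of (coneX n) (coneD n)
    (fun k => NatTrans.ext (funext fun U => ModuleCat.hom_ext (LinearMap.ext fun a => Prod.ext
      (by
        change dUp n k _ (dUp n (k + 1) _ a.1 + (-1 : ℝ) ^ (k + 1) • lowToUp n (k + 1) _ a.2) +
            (-1 : ℝ) ^ k • lowToUp n k _ (dLow n (k + 1) _ a.2) = 0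
        rw [map_add, map_smul, dUp_dUp, dUp_lowToUp, pow_succ]
        simp)
      (dLow_dLow n k U.unop a.2))))

theorem deligne_d (n k : ℕ) : (deligne n).d (k + 1) k = deligneD n k :=
  ChainComplex.of_d _ _ _

theorem cone_d (n k : ℕ) : (cone n).d (k + 1) k = coneD n k :=
  ChainComplex.of_d _ _ _

/-- The inclusion of the first row, as a morphism of presheaves. -/
def deligneToConeX (n k : ℕ) : deligneX n k ⟶ coneX n k where
  app U := ModuleCat.ofHom (LinearMap.inl ℝ (UpRow n k U.unop) (LowRow n k U.unop))
  naturality _ _ f := ModuleCat.hom_ext (LinearMap.ext fun _ => Prod.ext rfl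
    (map_zero (pullLow n k f.unop)).symm)

theorem deligneToConeX_comm (n k : ℕ) :
    deligneToConeX n (k + 1) ≫ coneD n k = deligneD n k ≫ deligneToConeX n k :=
  NatTrans.ext (funext fun U => ModuleCat.hom_ext (LinearMap.ext fun a => Prod.ext
    (by
      change dUp n k _ a + (-1 : ℝ) ^ k • lowToUp n k _ 0 = dUp n k _ a
      rw [map_zero, smul_zero, add_zero])
    (map_zero (dLow n k U.unop))))

/-- The inclusion `a ↦ (a, 0)` of the Deligne complex into the cone complex. -/
def deligneToCone (n : ℕ) : deligne n ⟶ cone n :=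
  ChainComplex.ofHom (deligneToConeX n) (fun k => by
    rw [deligne_d, cone_d]
    exact deligneToConeX_comm n k)

/-- The simplicial presheaf `B^n ℝ_conn`, the image of the Deligne complex under the Dold-Kan
correspondence. -/
def BConn (n : ℕ) : SimplicialObject Psh := Abelian.DoldKan.Γ.obj (deligne n)

/-- The simplicial presheaf `B^n ℝ_diff`, the image of the cone complex under the Dold-Kan
correspondence. -/
def BDiff (n : ℕ) : SimplicialObject Psh := Abelian.DoldKan.Γ.obj (cone n)

/-- The inclusion of `B^n ℝ_conn` into `B^n ℝ_diff`. -/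
def BInclusion (n : ℕ) : BConn n ⟶ BDiff n := Abelian.DoldKan.Γ.map (deligneToCone n)

/-- The morphism of simplicial objects that corresponds to a chain map out of the normalized complex
under the Dold-Kan correspondence. -/
def ofChainMap {X : SimplicialObject Psh} {C : ChainComplex Psh ℕ}
    (φ : Abelian.DoldKan.N.obj X ⟶ C) : X ⟶ Abelian.DoldKan.Γ.obj C :=
  Abelian.DoldKan.equivalence.toAdjunction.homEquiv X C φ

/-! ### Smooth `∞`-groupoids -/

/-- The simplicial presheaf of sets underlying a simplicial presheaf of vector spaces. -/
def underlying : SimplicialObject Psh ⥤ (CartSpᵒᵖ ⥤ SSet.{0}) :=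
  (Functor.whiskeringRight _ _ _).obj ((Functor.whiskeringRight _ _ _).obj
    (forget (ModuleCat.{0} ℝ))) ⋙ flipFunctor _ _ _

/-- A smooth `∞`-groupoid: a simplicial presheaf on Cartesian spaces with values in Kan complexes. -/
def IsSmoothInftyGroupoid (X : CartSpᵒᵖ ⥤ SSet.{0}) : Prop := ∀ U, SSet.KanComplex (X.obj U)

/-! ### Fibre integration -/

section Integration

variable {W : Type} [NormedAddCommGroup W] [NormedSpace ℝ W]

/-- An alternating form, with its degree rewritten along an equation. -/
def recast {m n : ℕ} (h : m = n) (φ : W [⋀^Fin n]→L[ℝ] ℝ) : W [⋀^Fin m]→L[ℝ] ℝ := h ▸ φ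

theorem recast_apply {m n : ℕ} (h : m = n) (φ : W [⋀^Fin n]→L[ℝ] ℝ) (v : Fin m → W) :
    recast h φ v = φ (v ∘ Fin.cast h.symm) := by
  subst h
  rfl

/-- The iterated contraction `ι_{w 0} ι_{w 1} ⋯ ι_{w (k-1)} φ`, that is, the form
`φ(w (k-1), …, w 1, w 0, -)`. -/
def contract {p : ℕ} : ∀ (k : ℕ) (_ : Fin k → W), W [⋀^Fin (p + k)]→L[ℝ] ℝ → W [⋀^Fin p]→L[ℝ] ℝ
  | 0, _, φ => φ
  | k + 1, w, φ => contract (p := p) k (fun i => w i.castSucc)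
      (ContinuousAlternatingMap.curryLeft (n := p + k) φ (w (Fin.last k)))

end Integration

/-- The fibre integral `∫_{Δ^k} α` of an `n`-form on `U × Δ^k`, a form of degree `p = n - k` on `U`:
its value at `u` is `∫_{Δ^k} (ι_{∂/∂t₁} ⋯ ι_{∂/∂t_k} α)(u, t) dt`. -/
def fiberIntegral {U : CartSp} {k n p : ℕ} (h : p + k = n) (α : Form (tube U k) n) (u : U.Space) :
    U.Space [⋀^Fin p]→L[ℝ] ℝ :=
  ∫ t in simplex k,
    (contract k (fun i => ((0 : U.Space), (Pi.single i (1 : ℝ) : Fin k → ℝ)))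
      (recast h (α.1 (u, t)))).compContinuousLinearMap
        (ContinuousLinearMap.inl ℝ U.Space (Fin k → ℝ))

/-- A morphism of presheaves from the `k`-cells of `exp_Δ(b^(n-1)ℝ)_diff` to degree `k` of the cone
complex is given by `α ↦ (∫_{Δ^k} α, ∫_{Δ^k} dα)`; the second entry is only present for `1 ≤ k`. -/
def IsFiberIntegration {n k : ℕ}
    (f : (expDiff n).obj (op (SimplexCategory.mk k)) ⟶ coneX n k) : Prop :=
  ∀ (U : CartSp) (α : (diffFamily n).cells U k) (c : UpRow n k U × LowRow n k U),
    (f.app (op U)).hom α = c →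
      (∀ (p : {p : ℕ // p + k = n}) (u : U.Space), (c.1 p).1 u = fiberIntegral p.2 α.1 u) ∧
      (∀ (p : {p : ℕ // p + k = n ∧ 1 ≤ k}) (u : U.Space),
        (c.2 p).1 u = fiberIntegral (show p.1 + 1 + k = n + 1 by omega)
          (extD (isBody_tube U k) n α.1) u)

/-! ### Sitting instants -/

/-- The orthogonal projection of the standard simplex, in barycentric coordinates, onto the affine
span of the face with vertex set `A`. -/
def faceProj {k : ℕ} (A : Finset (Fin (k + 1))) (t : Fin k → ℝ) : Fin k → ℝ :=
  fun j => if j.succ ∈ A then t j + (1 - ∑ a ∈ A, bary t a) / (A.card : ℝ) else 0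

open scoped Classical in
/-- The vertex set of the smallest face of the standard simplex that contains `t`. -/
def support {k : ℕ} (t : Fin k → ℝ) : Finset (Fin (k + 1)) := {i | bary t i ≠ 0}

/-- A form on `U × Δ^k` has sitting instants if, for every `u`, its restriction `α_u` to the fibre
`Δ^k` over `u` coincides near every point `q` of `Δ^k` with the pullback of its restriction to the
smallest face containing `q` along the orthogonal projection onto that face. -/
def HasSittingInstants {U : CartSp} {k n : ℕ} (α : Form (tube U k) n) : Prop :=
  ∀ u : U.Space, ∀ q ∈ simplex k, ∀ᶠ t in 𝓝[simplex k] q, ∀ v : Fin n → (Fin k → ℝ),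
    α.1 (u, t) (fun i => ((0 : U.Space), v i)) =
      α.1 (u, faceProj (support q) t)
        (fun i => ((0 : U.Space), fderiv ℝ (faceProj (support q)) t (v i)))

end FiberIntegration

/-! The heart is Stokes' theorem along the fibre (`integral_extD`). Let `α` be an `n`-form on `U ×
Δ^(k+1)`, and evaluate `dα` on `(∂/∂t_(k+1), …, ∂/∂t₁, v₁, …, v_p)`. The defining alternating sum
splits into derivatives of `α` in the directions of `U` and in those of the simplex. After
integration the former give, up to sign, `d∫α`, by differentiation under the integral. A derivative
along `∂/∂t_j` integrates, by Fubini and the fundamental theorem of calculus, to the difference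
between the slanted face opposite the vertex `0` and the coordinate face `t_j = 0`
(`integral_fderivWithin_vert`). The slanted contributions for all `j` add up to the integral of the
single face `∂₀α`; this is an identity of multilinear algebra (`sum_removeNth_fiberVec`).

The outcome is `∑ (-1)^i ∫∂_i α = d∫α + (-1)^k ∫dα` (`sum_fiberForm_faces`), which is the first
entry of the cone differential. The second entry is the same formula for `dα`, since `d² = 0`. The
cone is cut off beyond degree `n`, and there the terms `∫_{Δ^(n+1)} dα` must vanish: this is the
condition that defines `exp_diff` (`fiberForm_extD_eq_zero`). The stronger condition that defines
`exp_conn` makes every `∫dα` over a simplex of positive dimension vanish (`lowInt_eq_zero`). A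
degenerate cell is pulled back along a map of simplices that kills an edge vector or identifies two
of them, so its integrand is zero (`fiberForm_degenerate`).

The rest is formal. A simplicial vector space is a Kan complex, by Moore's filling argument
(`kanComplex_simplicialModule`). The morphisms of simplicial presheaves come from the Dold–Kan
equivalence, and their compatibility from the naturality of its adjunction. Sitting instants pass to
faces because the orthogonal projection onto a face spreads the missing barycentric mass equally
over the vertices of that face, a recipe that ignores the ambient simplex (`faceProj_simplexMap`).
-/

namespace FiberIntegration

/-! ### Simplicial modules are Kan complexes -/

section Kan

open Simplicial

variable (Y : SimplicialObject (ModuleCat.{0} ℝ))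

/-- A family of `(n+1)`-simplices whose faces agree like those of the faces of an
`(n+2)`-simplex, the `i`-th one being omitted. -/
def IsHornFamily {n : ℕ} (i : Fin (n + 3)) (x : Fin (n + 3) → Y _⦋n + 1⦌) : Prop :=
  ∀ (j k : Fin (n + 3)) (_ : j ≠ i) (_ : k ≠ i) (h : j < k),
    Y.δ (k.pred (Fin.ne_zero_of_lt h)) (x j) = Y.δ (j.castPred (Fin.ne_last_of_lt h)) (x k)

variable {Y}

theorem isHornFamily_faces {n : ℕ} (i : Fin (n + 3)) (y : Y _⦋n + 2⦌) :
    IsHornFamily Y i fun j => Y.δ j y := by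
  intro j k _ _ h
  obtain ⟨j, rfl⟩ := j.eq_castSucc_of_ne_last (Fin.ne_last_of_lt h)
  obtain ⟨k, rfl⟩ := k.eq_succ_of_ne_zero (Fin.ne_zero_of_lt h)
  have h' : j ≤ k := by simpa [Fin.castSucc_lt_succ_iff] using h
  have := Y.δ_comp_δ h'
  simpa using (ConcreteCategory.congr_hom this y).symm

theorem IsHornFamily.sub {n : ℕ} {i : Fin (n + 3)} {x z : Fin (n + 3) → Y _⦋n + 1⦌}
    (hx : IsHornFamily Y i x) (hz : IsHornFamily Y i z) :
    IsHornFamily Y i fun j => x j - z j := by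
  intro j k hj hk h
  rw [map_sub, map_sub, hx j k hj hk h, hz j k hj hk h]

/-- With `d_j s_r = s_(r-1) d_j` and the horn condition `d_j x_r = d_(r-1) x_j = 0`, correcting face
`r` by a degenerate simplex leaves the earlier faces `j < r` alone. It is applied to the error
family `x - dy` of a partial filler `y`. -/
theorem IsHornFamily.δ_σ_castSucc {n : ℕ} {i : Fin (n + 3)} {x : Fin (n + 3) → Y _⦋n + 1⦌}
    (hx : IsHornFamily Y i x) (r : Fin (n + 2)) (hr : r.castSucc < i) (j : Fin (n + 3))
    (hj : j < r.castSucc) (h0 : x j = 0) : Y.δ j (Y.σ r (x r.castSucc)) = 0 := by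
  have h := hx j r.castSucc (hj.trans hr).ne hr.ne hj
  rw [h0, map_zero] at h
  obtain ⟨j, rfl⟩ := j.eq_castSucc_of_ne_last (Fin.ne_last_of_lt hj)
  obtain ⟨r, rfl⟩ := r.eq_succ_of_ne_zero (by rintro rfl; simp at hj)
  have h' : j ≤ r.castSucc := by
    rw [Fin.le_def]; rw [Fin.lt_def] at hj; simp at hj ⊢; omega
  have e := ConcreteCategory.congr_hom (Y.δ_comp_σ_of_le h') (x r.succ.castSucc)
  simp only [ConcreteCategory.comp_apply] at e
  rw [e]
  simp only [Fin.castPred_castSucc] at h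
  rw [← h, map_zero]

/-- The counterpart above the missing index: face `r + 1` is corrected through `s_r`, so that `d_j`
moves past the degeneracy both for `j < i` and for `j > r + 1`. The corrections from the top
therefore spoil neither the low faces nor the high ones already done. -/
theorem IsHornFamily.δ_σ_succ {n : ℕ} {i : Fin (n + 3)} {x : Fin (n + 3) → Y _⦋n + 1⦌}
    (hx : IsHornFamily Y i x) (r : Fin (n + 2)) (hr : i < r.succ) (j : Fin (n + 3)) (hji : j ≠ i)
    (hj : j < i ∨ r.succ < j) (h0 : x j = 0) : Y.δ j (Y.σ r (x r.succ)) = 0 := by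
  rcases hj with hj | hj
  · have h := hx j r.succ hji hr.ne' (hj.trans hr)
    rw [h0, map_zero] at h
    obtain ⟨j, rfl⟩ := j.eq_castSucc_of_ne_last (Fin.ne_last_of_lt hj)
    rw [Fin.lt_def] at hr hj
    obtain ⟨r, rfl⟩ := r.eq_succ_of_ne_zero (by
      rintro rfl
      have h1 : ((0 : Fin (n + 2)).succ : ℕ) = 1 := rfl
      omega)
    have h' : j ≤ r.castSucc := by
      rw [Fin.le_def]; simp at hj hr ⊢; omega
    have e := ConcreteCategory.congr_hom (Y.δ_comp_σ_of_le h') (x r.succ.succ)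
    simp only [ConcreteCategory.comp_apply] at e
    rw [e]
    simp only [Fin.castPred_castSucc] at h
    rw [← h, map_zero]
  · have h := hx r.succ j hr.ne' hji hj
    rw [h0, map_zero] at h
    obtain ⟨j, rfl⟩ := j.eq_succ_of_ne_zero (Fin.ne_zero_of_lt hj)
    rw [Fin.lt_def] at hr hj
    obtain ⟨r, rfl⟩ := r.eq_castSucc_of_ne_last (by rintro rfl; simp at hr hj; omega)
    have h' : r.castSucc < j := by
      rw [Fin.lt_def]; simp at hj ⊢; omega
    have e := ConcreteCategory.congr_hom (Y.δ_comp_σ_of_gt h') (x r.castSucc.succ)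
    simp only [ConcreteCategory.comp_apply] at e
    rw [e]
    simp only [Fin.pred_succ] at h
    rw [h, map_zero]

/-- Moore's construction: the faces below the missing one are adjusted in increasing order, each by
adding `s_r(x_r - d_r y)`, where `d_r s_r = id`. -/
theorem IsHornFamily.exists_low {n : ℕ} {i : Fin (n + 3)} {x : Fin (n + 3) → Y _⦋n + 1⦌}
    (hx : IsHornFamily Y i x) (r : ℕ) (hr : r ≤ i) :
    ∃ y : Y _⦋n + 2⦌, ∀ j : Fin (n + 3), (j : ℕ) < r → Y.δ j y = x j := by
  induction r with
  | zero => exact ⟨0, fun j h => absurd h (by omega)⟩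
  | succ r ih =>
    obtain ⟨y, hy⟩ := ih (by omega)
    let s : Fin (n + 2) := ⟨r, by omega⟩
    have hz := hx.sub (isHornFamily_faces i y)
    refine ⟨y + Y.σ s (x s.castSucc - Y.δ s.castSucc y), fun j hj => ?_⟩
    rw [map_add]
    by_cases hjr : (j : ℕ) < r
    · rw [hz.δ_σ_castSucc s (by rw [Fin.lt_def]; simp [s]; omega) j
        (by rw [Fin.lt_def]; simpa [s] using hjr) (by simp [hy j hjr]), hy j hjr, add_zero]
    · obtain rfl : j = s.castSucc := by ext; simp [s]; omega
      have e := ConcreteCategory.congr_hom (Y.δ_comp_σ_self (i := s)) (x s.castSucc - Y.δ s.castSucc y)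
      simp only [ConcreteCategory.comp_apply, ConcreteCategory.id_apply] at e
      rw [e, add_sub_cancel]

/-- Second half of Moore's construction: starting from a filler of the low faces, the `m` highest
faces are adjusted in decreasing order, now with `d_(r+1) s_r = id`. -/
theorem IsHornFamily.exists_fill {n : ℕ} {i : Fin (n + 3)} {x : Fin (n + 3) → Y _⦋n + 1⦌}
    (hx : IsHornFamily Y i x) (m : ℕ) (hm : m + i ≤ n + 2) :
    ∃ y : Y _⦋n + 2⦌, ∀ j : Fin (n + 3), ((j : ℕ) < i ∨ n + 2 < (j : ℕ) + m) → Y.δ j y = x j := by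
  induction m with
  | zero =>
    obtain ⟨y, hy⟩ := hx.exists_low i le_rfl
    exact ⟨y, fun j hj => hy j (by omega)⟩
  | succ m ih =>
    obtain ⟨y, hy⟩ := ih (by omega)
    -- The next face from the top is `n + 2 - m`, which is `s.succ`.
    let s : Fin (n + 2) := ⟨n + 1 - m, by omega⟩
    have hz := hx.sub (isHornFamily_faces i y)
    refine ⟨y + Y.σ s (x s.succ - Y.δ s.succ y), fun j hj => ?_⟩
    rw [map_add]
    by_cases hjr : (j : ℕ) < i ∨ n + 2 < (j : ℕ) + m
    · rw [hz.δ_σ_succ s (by rw [Fin.lt_def]; simp [s]; omega) j (by rintro rfl; omega)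
        (by rw [Fin.lt_def, Fin.lt_def]; simp [s]; omega) (by simp [hy j hjr]), hy j hjr, add_zero]
    · obtain rfl : j = s.succ := by ext; simp [s]; omega
      have e := ConcreteCategory.congr_hom (Y.δ_comp_σ_succ (i := s)) (x s.succ - Y.δ s.succ y)
      simp only [ConcreteCategory.comp_apply, ConcreteCategory.id_apply] at e
      rw [e, add_sub_cancel]

variable (Y) in
/-- The simplicial set underlying a simplicial module is a Kan complex. -/
theorem kanComplex_simplicialModule :
    SSet.KanComplex (((SimplicialObject.whiskering _ _).obj (forget (ModuleCat.{0} ℝ))).obj Y) := by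
  rw [SSet.KanComplex.iff]
  intro n i f hf
  let x : Fin (n + 2) → Y _⦋n⦌ := fun j => if h : j ≠ i then SSet.yonedaEquiv (f j h) else 0
  have hxf : ∀ j (h : j ≠ i), SSet.yonedaEquiv (f j h) = x j := fun j h => by simp [x, h]
  suffices H : ∃ y : Y _⦋n + 1⦌, ∀ j, j ≠ i → Y.δ j y = x j by
    obtain ⟨y, hy⟩ := H
    refine ⟨SSet.yonedaEquiv.symm y, fun j hj => ?_⟩
    refine (SSet.stdSimplex.δ_comp_yonedaEquiv_symm _ _).trans
      ((Equiv.symm_apply_eq _).2 ((hy j hj).trans (hxf j hj).symm))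
  -- A horn in `Δ^1` is one vertex without compatibility conditions, and a degenerate edge fills it.
  obtain _ | n := n
  · fin_cases i
    · refine ⟨Y.σ 0 (x 1), fun j hj => ?_⟩
      obtain rfl : j = 1 := by fin_cases j <;> simp_all
      exact ConcreteCategory.congr_hom (Y.δ_comp_σ_succ (i := (0 : Fin 1))) (x 1)
    · refine ⟨Y.σ 0 (x 0), fun j hj => ?_⟩
      obtain rfl : j = 0 := by fin_cases j <;> simp_all
      exact ConcreteCategory.congr_hom (Y.δ_comp_σ_self (i := (0 : Fin 1))) (x 0)
  · have hx : IsHornFamily Y i x := by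
      intro j k hj hk h
      have := congrArg SSet.yonedaEquiv (hf j k hj hk h)
      rw [SSet.stdSimplex.yonedaEquiv_δ_comp, SSet.stdSimplex.yonedaEquiv_δ_comp, hxf, hxf] at this
      exact this
    -- With `m = n + 2 - i` the high faces are exactly those with index above `i`.
    obtain ⟨y, hy⟩ := hx.exists_fill (n + 2 - i) (by omega)
    refine ⟨y, fun j hj => hy j ?_⟩
    have : (j : ℕ) ≠ i := fun h => hj (Fin.ext h)
    omega

end Kan

theorem isSmoothInftyGroupoid_underlying (X : SimplicialObject Psh) :
    IsSmoothInftyGroupoid (underlying.obj X) := fun U =>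
  kanComplex_simplicialModule (((SimplicialObject.whiskering _ _).obj ((evaluation _ _).obj U)).obj X)

/-! ### Sitting instants -/

/-- The definition only prescribes the coordinates `1, …, k`. The vertex `0` obeys the same rule
because the proposed coordinates sum to `1`, which needs a nonempty `A` to receive the missing mass.
-/
theorem bary_faceProj {k : ℕ} {A : Finset (Fin (k + 1))} (hA : A.Nonempty) (t : Fin k → ℝ)
    (j : Fin (k + 1)) : bary (faceProj A t) j =
      if j ∈ A then bary t j + (1 - ∑ a ∈ A, bary t a) / (A.card : ℝ) else 0 := by
  set g : Fin (k + 1) → ℝ := fun j =>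
    if j ∈ A then bary t j + (1 - ∑ a ∈ A, bary t a) / (A.card : ℝ) else 0 with hg
  have hs : ∑ j, g j = 1 := by
    have hc : (A.card : ℝ) ≠ 0 := by exact_mod_cast hA.card_ne_zero
    rw [hg, Finset.sum_ite_mem, Finset.univ_inter, Finset.sum_add_distrib, Finset.sum_const,
      nsmul_eq_mul]
    field_simp
    ring
  have hj : ∀ j : Fin k, faceProj A t j = g j.succ := fun j => by
    simp [faceProj, hg, bary]
  change bary (faceProj A t) j = g j
  induction j using Fin.cases with
  | zero =>
    rw [Fin.sum_univ_succ] at hs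
    simp only [bary, Fin.cons_zero, hj]
    linarith
  | succ j => simp only [bary, Fin.cons_succ, hj]

theorem faceProj_mem_simplex {k : ℕ} {A : Finset (Fin (k + 1))} (hA : A.Nonempty) {t : Fin k → ℝ}
    (ht : t ∈ simplex k) : faceProj A t ∈ simplex k := by
  rw [mem_simplex_iff] at ht ⊢
  intro j
  rw [bary_faceProj hA]
  split_ifs
  · have h1 : ∑ a ∈ A, bary t a ≤ 1 := by
      rw [← sum_bary t]
      exact Finset.sum_le_sum_of_subset_of_nonneg (Finset.subset_univ _) fun i _ _ => ht i
    exact add_nonneg (ht j) (div_nonneg (by linarith) (by positivity))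
  · exact le_rfl

theorem contDiff_faceProj {k : ℕ} (A : Finset (Fin (k + 1))) : ContDiff ℝ ∞ (faceProj A) := by
  refine contDiff_pi.2 fun j => ?_
  unfold faceProj
  split_ifs
  · exact (contDiff_apply ℝ ℝ j).add
      ((contDiff_const.sub (ContDiff.sum fun i _ => contDiff_bary i)).div_const _)
  · exact contDiff_const

theorem support_nonempty {k : ℕ} (t : Fin k → ℝ) : (support t).Nonempty := by
  classical
  by_contra h
  rw [Finset.not_nonempty_iff_eq_empty, support, Finset.filter_eq_empty_iff] at h
  have := sum_bary t
  rw [Finset.sum_eq_zero fun i hi => not_not.1 (h hi)] at this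
  exact zero_ne_one this

section InjectiveFace

variable {k l : ℕ} {θ : Fin (k + 1) → Fin (l + 1)}

theorem bary_simplexMap_apply (hθ : Function.Injective θ) (t : Fin k → ℝ) (i : Fin (k + 1)) :
    bary (simplexMap θ t) (θ i) = bary t i := by
  rw [bary_simplexMap, Finset.sum_eq_single_of_mem i (by simp)]
  intro b hb hne
  exact absurd (hθ (by simpa using hb)) hne

theorem bary_simplexMap_of_notMem {j : Fin (l + 1)} (hj : ∀ i, θ i ≠ j) (t : Fin k → ℝ) :
    bary (simplexMap θ t) j = 0 := by
  rw [bary_simplexMap]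
  refine Finset.sum_eq_zero fun i hi => ?_
  exact absurd (by simpa using hi) (hj i)

theorem support_simplexMap (hθ : Function.Injective θ) (t : Fin k → ℝ) :
    support (simplexMap θ t) = (support t).map ⟨θ, hθ⟩ := by
  ext j
  simp only [support, Finset.mem_filter, Finset.mem_univ, true_and, Finset.mem_map,
    Function.Embedding.coeFn_mk]
  constructor
  · intro h
    by_contra hc
    push Not at hc
    by_cases hj : ∃ i, θ i = j
    · obtain ⟨i, rfl⟩ := hj
      rw [bary_simplexMap_apply hθ] at h
      exact hc i h rfl
    · exact h (bary_simplexMap_of_notMem (by simpa using hj) t)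
  · rintro ⟨i, hi, rfl⟩
    rwa [bary_simplexMap_apply hθ]

/-- An injective vertex map carries barycentric coordinates over unchanged and puts `0` elsewhere,
so the missing mass and the number of vertices that share it agree on both sides. -/
theorem faceProj_simplexMap (hθ : Function.Injective θ) {A : Finset (Fin (k + 1))}
    (hA : A.Nonempty) (t : Fin k → ℝ) :
    faceProj (A.map ⟨θ, hθ⟩) (simplexMap θ t) = simplexMap θ (faceProj A t) := by
  apply bary_injective
  funext j
  rw [bary_faceProj (hA.map), Finset.sum_map, Finset.card_map]
  simp only [Function.Embedding.coeFn_mk, bary_simplexMap_apply hθ]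
  by_cases hj : ∃ i, θ i = j
  · obtain ⟨i, rfl⟩ := hj
    rw [bary_simplexMap_apply hθ, bary_simplexMap_apply hθ, bary_faceProj hA]
    simp
  · push Not at hj
    rw [bary_simplexMap_of_notMem hj, bary_simplexMap_of_notMem hj, if_neg]
    intro hm
    obtain ⟨i, -, hi⟩ := Finset.mem_map.1 hm
    exact hj i hi

end InjectiveFace

theorem cellMap_apply {n : ℕ} {U V : CartSp} (f : U ⟶ V) {a b : SimplexCategory} (θ : a ⟶ b)
    (α : Form (tube V b.len) n) {x : U.Space × (Fin a.len → ℝ)} (hx : x ∈ tube U a.len) :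
    (cellMap n f θ α).1 x = (α.1 (f.1 x.1, simplexMap θ.toOrderHom x.2)).compContinuousLinearMap
      ((fderiv ℝ f.1 x.1).prodMap (fderiv ℝ (simplexMap θ.toOrderHom) x.2)) := by
  refine (pullback_apply _ _ _ _ hx).trans ?_
  rw [fderiv_cellMap]
  rfl

theorem cellMap_vertical {n : ℕ} {U V : CartSp} (f : U ⟶ V) {a b : SimplexCategory} (θ : a ⟶ b)
    (α : Form (tube V b.len) n) {u : U.Space} {t : Fin a.len → ℝ} (ht : t ∈ simplex a.len)
    (v : Fin n → Fin a.len → ℝ) :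
    (cellMap n f θ α).1 (u, t) (fun i => ((0 : U.Space), v i)) =
      α.1 (f.1 u, simplexMap θ.toOrderHom t)
        (fun i => ((0 : V.Space), fderiv ℝ (simplexMap θ.toOrderHom) t (v i))) := by
  rw [cellMap_apply f θ α (x := (u, t)) (Set.mk_mem_prod (Set.mem_univ _) ht),
    ContinuousAlternatingMap.compContinuousLinearMap_apply]
  simp [Function.comp_def]

theorem HasSittingInstants.cellMap {n : ℕ} {U V : CartSp} (f : U ⟶ V) {a b : SimplexCategory}
    (θ : a ⟶ b) {α : Form (tube V b.len) n} (hθ : Function.Injective θ.toOrderHom)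
    (hα : HasSittingInstants α) : HasSittingInstants (cellMap n f θ α) := by
  intro u q hq
  have hθc := contDiff_simplexMap θ.toOrderHom
  have hm := simplexMap_mapsTo θ.toOrderHom
  have h := hα (f.1 u) (simplexMap θ.toOrderHom q) (hm hq)
  have ht : Filter.Tendsto (simplexMap θ.toOrderHom) (𝓝[simplex a.len] q)
      (𝓝[simplex b.len] (simplexMap θ.toOrderHom q)) :=
    hθc.continuous.continuousWithinAt.tendsto_nhdsWithin hm
  filter_upwards [ht.eventually h, self_mem_nhdsWithin] with t h ht v
  have hs := support_nonempty q
  -- The projected point must stay in the simplex, since a pulled back form is given by its formula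
  -- only there. What remains is an equality of the tangent vectors, the derivative of the
  -- commutation of projection and face map.
  rw [cellMap_vertical f θ α ht, cellMap_vertical f θ α (faceProj_mem_simplex hs ht), h,
    support_simplexMap hθ, faceProj_simplexMap hθ hs]
  congr 1
  funext i
  congr 1
  have hd : ∀ {k l : ℕ} {F : (Fin k → ℝ) → Fin l → ℝ} (_ : ContDiff ℝ ∞ F) x,
    DifferentiableAt ℝ F x := fun hF x => hF.differentiable (by simp) x
  have e : faceProj ((support q).map ⟨_, hθ⟩) ∘ simplexMap θ.toOrderHom =
      simplexMap θ.toOrderHom ∘ faceProj (support q) :=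
    funext fun t => faceProj_simplexMap hθ hs t
  have e' := congrArg (fun F => fderiv ℝ F t (v i)) e
  rwa [fderiv_comp t (hd (contDiff_faceProj _) _) (hd hθc _),
    fderiv_comp t (hd hθc _) (hd (contDiff_faceProj _) _)] at e'

/-! ### Integrals depending on parameters -/

section Parametric

theorem continuousOn_slice {E T X : Type} [TopologicalSpace E] [TopologicalSpace T]
    [TopologicalSpace X] {K : Set T} {g : E × T → X}
    (hg : ContinuousOn g (Set.univ ×ˢ K)) (u : E) : ContinuousOn (fun t => g (u, t)) K :=
  hg.comp (by fun_prop) fun t ht => ⟨Set.mem_univ _, ht⟩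

open MeasureTheory

variable {E T : Type} [NormedAddCommGroup E] [NormedSpace ℝ E] [ProperSpace E]
  [NormedAddCommGroup T] [NormedSpace ℝ T] [MeasurableSpace T] [BorelSpace T]
  [SecondCountableTopology T] {μ : Measure T} [IsFiniteMeasureOnCompacts μ] {K : Set T}

/-- Differentiation under the integral. The set of parameters is the whole of `E`, so the derivative
within `E × K`, restricted to the directions of `E`, is an honest derivative of each slice. -/
theorem hasFDerivAt_setIntegral {F : Type} [NormedAddCommGroup F] [NormedSpace ℝ F]
    (hK : IsCompact K) (hS : UniqueDiffOn ℝ ((Set.univ : Set E) ×ˢ K))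
    {g : E × T → F} (hg : ContDiffOn ℝ ∞ g (Set.univ ×ˢ K)) (u : E) :
    HasFDerivAt (fun u => ∫ t in K, g (u, t) ∂μ)
      (∫ t in K, (fderivWithin ℝ g (Set.univ ×ˢ K) (u, t)).comp (.inl ℝ E T) ∂μ) u := by
  have hc : ContinuousOn (fun x => (fderivWithin ℝ g (Set.univ ×ˢ K) x).comp (.inl ℝ E T))
      (Set.univ ×ˢ K) :=
    (hg.continuousOn_fderivWithin hS (by simp)).clm_comp continuousOn_const
  -- Properness of `E` makes this product compact, so a constant dominates the derivatives for
  -- parameters near `u`.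
  obtain ⟨C, hC⟩ := ((isCompact_closedBall u 1).prod hK).exists_bound_of_continuousOn
    (hc.mono (Set.prod_mono_left (Set.subset_univ _)))
  refine hasFDerivAt_integral_of_dominated_of_fderiv_le (bound := fun _ => C)
    (Metric.ball_mem_nhds u one_pos) (Filter.Eventually.of_forall fun w => ?_) ?_ ?_ ?_ ?_ ?_
    (F := fun w t => g (w, t))
    (F' := fun w t => (fderivWithin ℝ g (Set.univ ×ˢ K) (w, t)).comp (.inl ℝ E T))
  · exact (continuousOn_slice hg.continuousOn w).aestronglyMeasurable hK.measurableSet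
  · exact (continuousOn_slice hg.continuousOn u).integrableOn_compact hK
  · exact (continuousOn_slice hc u).aestronglyMeasurable hK.measurableSet
  · refine (ae_restrict_iff' hK.measurableSet).2 (Filter.Eventually.of_forall fun t ht w hw => ?_)
    exact hC (w, t) ⟨Metric.ball_subset_closedBall hw, ht⟩
  · exact continuousOn_const.integrableOn_compact hK
  · refine (ae_restrict_iff' hK.measurableSet).2 (Filter.Eventually.of_forall fun t ht w hw => ?_)
    have h := ((hg.differentiableOn (by simp)) (w, t) ⟨Set.mem_univ _, ht⟩).hasFDerivWithinAt
    have h' := h.comp (s := Set.univ) (f := fun w => (w, t)) w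
      (hasFDerivAt_prodMk_left w t).hasFDerivWithinAt fun w _ => ⟨Set.mem_univ _, ht⟩
    exact hasFDerivWithinAt_univ.1 h'

theorem fderiv_setIntegral_apply {F : Type} [NormedAddCommGroup F] [NormedSpace ℝ F]
    [CompleteSpace F] (hK : IsCompact K) (hS : UniqueDiffOn ℝ ((Set.univ : Set E) ×ˢ K))
    {g : E × T → F} (hg : ContDiffOn ℝ ∞ g (Set.univ ×ˢ K)) (L : F →L[ℝ] ℝ) (u y : E) :
    L (fderiv ℝ (fun u => ∫ t in K, g (u, t) ∂μ) u y) =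
      ∫ t in K, L (fderivWithin ℝ g (Set.univ ×ˢ K) (u, t) (y, 0)) ∂μ := by
  have hi : IntegrableOn
      (fun t => (fderivWithin ℝ g (Set.univ ×ˢ K) (u, t)).comp (.inl ℝ E T)) K μ :=
    (continuousOn_slice (g := fun x => (fderivWithin ℝ g (Set.univ ×ˢ K) x).comp (.inl ℝ E T))
      ((hg.continuousOn_fderivWithin hS (by simp)).clm_comp continuousOn_const)
      u).integrableOn_compact hK
  rw [(hasFDerivAt_setIntegral hK hS hg u).fderiv]
  exact ((L ∘L ContinuousLinearMap.apply ℝ F y).integral_comp_comm hi).symm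

theorem contDiff_setIntegral {F : Type} [NormedAddCommGroup F] [NormedSpace ℝ F]
    (hK : IsCompact K) (hS : UniqueDiffOn ℝ ((Set.univ : Set E) ×ˢ K))
    {g : E × T → F} (hg : ContDiffOn ℝ ∞ g (Set.univ ×ˢ K)) :
    ContDiff ℝ ∞ (fun u => ∫ t in K, g (u, t) ∂μ) := by
  rw [contDiff_infty]
  intro m
  -- The derivative is again a parameter integral, with values in another space of linear maps;
  -- hence `F` has to vary.
  induction m generalizing F with
  | zero =>
    rw [Nat.cast_zero, contDiff_zero]
    exact continuous_iff_continuousAt.2 fun u => (hasFDerivAt_setIntegral hK hS hg u).continuousAt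
  | succ m ih =>
    rw [Nat.cast_succ, contDiff_succ_iff_hasFDerivAt]
    exact ⟨_, ih ((hg.fderivWithin hS (by simp)).clm_comp contDiffOn_const),
      hasFDerivAt_setIntegral hK hS hg⟩

end Parametric

/-! ### Integration over the simplex -/

section Simplex

open MeasureTheory

theorem isClosed_simplex (k : ℕ) : IsClosed (simplex k) := by
  have h : simplex k = (⋂ i, {t | 0 ≤ t i}) ∩ {t | ∑ i, t i ≤ 1} := by
    ext t
    simp [simplex]
  rw [h]
  exact (isClosed_iInter fun i => isClosed_le continuous_const (continuous_apply i)).inter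
    (isClosed_le (by fun_prop) continuous_const)

theorem isCompact_simplex (k : ℕ) : IsCompact (simplex k) := by
  refine (isCompact_Icc (a := (0 : Fin k → ℝ)) (b := 1)).of_isClosed_subset (isClosed_simplex k) ?_
  rintro t ⟨h0, h1⟩
  exact ⟨h0, fun i => (Finset.single_le_sum (fun j _ => h0 j) (Finset.mem_univ i)).trans h1⟩

theorem measurableSet_simplex (k : ℕ) : MeasurableSet (simplex k) :=
  (isClosed_simplex k).measurableSet

theorem isBody_simplex (k : ℕ) : IsBody (simplex k) := by
  -- The simplex is seen as the tube over `ℝ^0`.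
  have h := isBody_tube ⟨0⟩ k
  constructor
  · have e : simplex k =
        LinearMap.snd ℝ (CartSp.mk 0).Space (Fin k → ℝ) '' tube ⟨0⟩ k := by
      ext t
      constructor
      · exact fun ht => ⟨(0, t), ⟨Set.mem_univ _, ht⟩, rfl⟩
      · rintro ⟨x, hx, rfl⟩
        exact hx.2
    rw [e]
    exact h.convex.linear_image _
  · obtain ⟨x, hx⟩ := h.nonempty
    rw [tube, interior_prod_eq] at hx
    exact ⟨x.2, hx.2⟩

theorem insertNth_mem_simplex_iff {k : ℕ} (j : Fin (k + 1)) (x : ℝ) (s : Fin k → ℝ) :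
    j.insertNth x s ∈ simplex (k + 1) ↔ s ∈ simplex k ∧ x ∈ Set.Icc 0 (1 - ∑ i, s i) := by
  simp only [simplex, Set.mem_ofPred_eq, Fin.forall_iff_succAbove j, Fin.insertNth_apply_same,
    Fin.insertNth_apply_succAbove, Fin.sum_univ_succAbove _ j, Set.mem_Icc]
  constructor
  · rintro ⟨⟨h0, h1⟩, h2⟩
    exact ⟨⟨h1, by linarith⟩, h0, by linarith⟩
  · rintro ⟨⟨h1, h2⟩, h0, h3⟩
    exact ⟨⟨h0, h1⟩, by linarith⟩

/-- Fubini's theorem for the simplex, one coordinate being integrated first. -/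
theorem integral_simplex_succ {k : ℕ} (j : Fin (k + 1)) {g : (Fin (k + 1) → ℝ) → ℝ}
    (hg : ContinuousOn g (simplex (k + 1))) :
    ∫ t in simplex (k + 1), g t =
      ∫ s in simplex k, ∫ x in (0 : ℝ)..(1 - ∑ i, s i), g (j.insertNth x s) := by
  let e := (MeasurableEquiv.piFinSuccAbove (fun _ : Fin (k + 1) => ℝ) j).symm
  have he : MeasurePreserving e :=
    (volume_preserving_piFinSuccAbove (fun _ : Fin (k + 1) => ℝ) j).symm _
  have hee : ∀ x s, e (x, s) = j.insertNth x s := fun x s => rfl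
  have hint : Integrable ((simplex (k + 1)).indicator g) :=
    (hg.integrableOn_compact (isCompact_simplex _)).integrable_indicator (measurableSet_simplex _)
  have hint' : Integrable (fun z : ℝ × (Fin k → ℝ) => (simplex (k + 1)).indicator g (e z))
      (volume.prod volume) := (he.integrable_comp_emb e.measurableEmbedding).2 hint
  rw [← integral_indicator (measurableSet_simplex _), ← he.integral_comp e.measurableEmbedding,
    Measure.volume_eq_prod, integral_prod_symm _ hint', ← integral_indicator (measurableSet_simplex _)]
  congr 1
  funext s
  by_cases hs : s ∈ simplex k
  · rw [Set.indicator_of_mem hs, intervalIntegral.integral_of_le (by linarith [hs.2]),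
      ← integral_Icc_eq_integral_Ioc, ← integral_indicator measurableSet_Icc]
    congr 1
    funext x
    rw [hee]
    by_cases hx : x ∈ Set.Icc 0 (1 - ∑ i, s i)
    · rw [Set.indicator_of_mem hx,
        Set.indicator_of_mem ((insertNth_mem_simplex_iff j x s).2 ⟨hs, hx⟩)]
    · rw [Set.indicator_of_notMem hx,
        Set.indicator_of_notMem fun h => hx ((insertNth_mem_simplex_iff j x s).1 h).2]
  · rw [Set.indicator_of_notMem hs]
    refine integral_eq_zero_of_ae (Filter.Eventually.of_forall fun x => ?_)
    exact Set.indicator_of_notMem (fun h => hs ((insertNth_mem_simplex_iff j x s).1 h).1) _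

/-- The integral of a partial derivative over the simplex. -/
theorem integral_simplex_fderivWithin {k : ℕ} (j : Fin (k + 1)) {g : (Fin (k + 1) → ℝ) → ℝ}
    (hg : ContDiffOn ℝ 1 g (simplex (k + 1))) :
    ∫ t in simplex (k + 1), fderivWithin ℝ g (simplex (k + 1)) t (Pi.single j 1) =
      ∫ s in simplex k, (g (j.insertNth (1 - ∑ i, s i) s) - g (j.insertNth 0 s)) := by
  have hc : ContinuousOn (fun t => fderivWithin ℝ g (simplex (k + 1)) t (Pi.single j 1))
      (simplex (k + 1)) :=
    (hg.continuousOn_fderivWithin (isBody_simplex _).uniqueDiffOn le_rfl).clm_apply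
      continuousOn_const
  rw [integral_simplex_succ j hc]
  refine setIntegral_congr_fun (measurableSet_simplex k) fun s hs => ?_
  have hmaps : Set.MapsTo (fun x : ℝ => j.insertNth (α := fun _ => ℝ) x s)
      (Set.Icc 0 (1 - ∑ i, s i)) (simplex (k + 1)) :=
    fun x hx => (insertNth_mem_simplex_iff j x s).2 ⟨hs, hx⟩
  have hline : ∀ x, HasDerivAt (fun x : ℝ => j.insertNth (α := fun _ => ℝ) x s)
      (Pi.single j 1) x := by
    intro x
    rw [hasDerivAt_pi]
    intro i
    rcases Fin.eq_self_or_eq_succAbove j i with rfl | ⟨i, rfl⟩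
    · simpa using hasDerivAt_id' x
    · simpa [Fin.succAbove_ne] using hasDerivAt_const x (s i)
  have hlc : ContinuousOn (fun x : ℝ => j.insertNth (α := fun _ => ℝ) x s)
      (Set.Icc 0 (1 - ∑ i, s i)) := fun x _ => (hline x).continuousAt.continuousWithinAt
  have hle : (0 : ℝ) ≤ 1 - ∑ i, s i := by linarith [hs.2]
  refine intervalIntegral.integral_eq_sub_of_hasDerivAt_of_le hle
    (f := fun x => g (j.insertNth x s)) (hg.continuousOn.comp hlc hmaps) ?_ ?_
  · intro x hx
    have h := ((hg.differentiableOn one_ne_zero) _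
      (hmaps (Set.Ioo_subset_Icc_self hx))).hasFDerivWithinAt
    exact (h.comp_hasDerivWithinAt x (hline x).hasDerivWithinAt hmaps).hasDerivAt
      (Icc_mem_nhds hx.1 hx.2)
  · exact ContinuousOn.intervalIntegrable_of_Icc hle (hc.comp hlc hmaps)

theorem insertNth_zero_eq_simplexMap {k : ℕ} (j : Fin (k + 1)) (s : Fin k → ℝ) :
    j.insertNth 0 s = simplexMap j.succ.succAbove s := by
  funext i
  change _ = ∑ l with j.succ.succAbove l = i.succ, bary s l
  rcases Fin.eq_self_or_eq_succAbove j i with rfl | ⟨i, rfl⟩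
  · simp [Fin.succAbove_ne, bary]
  · rw [← Fin.succ_succAbove_succ]
    simp only [Fin.succAbove_right_inj]
    simp [Finset.filter_eq', bary]

/-- The upper end of the line in direction `j` runs over the slanted face, but with the vertex `e_j`
listed first. The cycle records this reordering, which `integral_simplexMap_perm` later removes. -/
theorem insertNth_eq_simplexMap {k : ℕ} (j : Fin (k + 1)) (s : Fin k → ℝ) :
    j.insertNth (1 - ∑ i, s i) s = simplexMap (Fin.succ ∘ j.cycleRange.symm) s := by
  funext i
  change _ = ∑ l with (j.cycleRange.symm l).succ = i.succ, bary s l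
  simp only [Fin.succ_inj]
  rcases Fin.eq_self_or_eq_succAbove j i with rfl | ⟨i, rfl⟩
  · have h : ∀ l, i.cycleRange.symm l = i ↔ l = 0 := fun l =>
      ⟨fun h => i.cycleRange.symm.injective (h.trans (Fin.cycleRange_symm_zero i).symm),
        fun h => h ▸ Fin.cycleRange_symm_zero i⟩
    simp [h, Finset.filter_eq', bary]
  · have h : ∀ l, j.cycleRange.symm l = j.succAbove i ↔ l = i.succ := fun l =>
      ⟨fun h => j.cycleRange.symm.injective (h.trans (Fin.cycleRange_symm_succ j i).symm),
        fun h => h ▸ Fin.cycleRange_symm_succ j i⟩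
    simp [h, Finset.filter_eq', bary]

theorem simplexMap_perm_comp {k : ℕ} (σ : Equiv.Perm (Fin (k + 1))) (t : Fin k → ℝ) :
    simplexMap σ (simplexMap σ.symm t) = t := by
  have h := congrFun (simplexMap_comp (σ.symm : Fin (k + 1) → Fin (k + 1)) σ) t
  rw [Equiv.self_comp_symm, simplexMap_id] at h
  exact h.symm

theorem fderiv_simplexMap {k l : ℕ} (θ : Fin (k + 1) → Fin (l + 1)) (t v : Fin k → ℝ)
    (j : Fin l) : fderiv ℝ (simplexMap θ) t v j =
      ∑ i with θ i = j.succ, (Fin.cons (-∑ i, v i) v : Fin (k + 1) → ℝ) i := by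
  have hb : ∀ i, HasFDerivAt (fun t : Fin k → ℝ => bary t i)
      ((Fin.cons (-∑ i, ContinuousLinearMap.proj i) (fun i => ContinuousLinearMap.proj i) :
        Fin (k + 1) → ((Fin k → ℝ) →L[ℝ] ℝ)) i) t := by
    intro i
    induction i using Fin.cases with
    | zero =>
      simp only [bary, Fin.cons_zero]
      exact (HasFDerivAt.fun_sum fun i _ => hasFDerivAt_apply i t).const_sub 1
    | succ i => simpa only [bary, Fin.cons_succ] using hasFDerivAt_apply i t
  have h : HasFDerivAt (simplexMap θ) (ContinuousLinearMap.pi fun j : Fin l =>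
      ∑ i with θ i = j.succ, (Fin.cons (-∑ i, ContinuousLinearMap.proj i)
        (fun i => ContinuousLinearMap.proj i) : Fin (k + 1) → ((Fin k → ℝ) →L[ℝ] ℝ)) i) t :=
    hasFDerivAt_pi.2 fun j => HasFDerivAt.fun_sum fun i _ => hb i
  rw [h.fderiv, ContinuousLinearMap.pi_apply, sum_apply]
  refine Finset.sum_congr rfl fun i _ => ?_
  induction i using Fin.cases with
  | zero => simp
  | succ i => simp

/-- The integral over the simplex is invariant under permutations of the vertices. -/
theorem integral_simplexMap_perm {k : ℕ} (σ : Equiv.Perm (Fin (k + 1))) (g : (Fin k → ℝ) → ℝ) :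
    ∫ t in simplex k, g (simplexMap σ t) = ∫ t in simplex k, g t := by
  -- The map is affine, so its derivative at `0` is its derivative everywhere.
  let D : (Fin k → ℝ) →L[ℝ] (Fin k → ℝ) := fderiv ℝ (simplexMap σ) 0
  have hD : ∀ t ∈ simplex k, HasFDerivWithinAt (simplexMap σ) D (simplex k) t := by
    intro t _
    have e : D = fderiv ℝ (simplexMap σ) t := by
      ext v j
      rw [fderiv_simplexMap, fderiv_simplexMap]
    rw [e]
    exact ((contDiff_simplexMap σ).differentiable (by simp) t).hasFDerivAt.hasFDerivWithinAt
  have hinj : Set.InjOn (simplexMap (σ : Fin (k + 1) → Fin (k + 1))) (simplex k) := by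
    intro s _ t _ h
    have := congrArg (simplexMap σ.symm) h
    have e := simplexMap_perm_comp σ.symm
    rw [Equiv.symm_symm] at e
    rwa [e, e] at this
  have himg : simplexMap σ '' simplex k = simplex k := by
    refine Set.Subset.antisymm (simplexMap_mapsTo _).image_subset fun t ht => ?_
    exact ⟨_, simplexMap_mapsTo _ ht, simplexMap_perm_comp σ t⟩
  have key := fun g : (Fin k → ℝ) → ℝ => integral_image_eq_integral_abs_det_fderiv_smul volume
    (measurableSet_simplex k) hD hinj g
  rw [himg] at key
  have hpos : 0 < volume.real (simplex k) :=
    ENNReal.toReal_pos (Measure.measure_pos_of_nonempty_interior _ (isBody_simplex k).nonempty).ne'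
      (isCompact_simplex k).measure_lt_top.ne
  -- No determinant is computed: the map sends the simplex onto itself, so the change of variables
  -- for the constant `1` compares its positive finite volume with `|det|` times that volume.
  have hdet : |D.det| = 1 := by
    have := key fun _ => 1
    simp only [smul_eq_mul, mul_one, setIntegral_const] at this
    nlinarith
  rw [key g]
  simp [hdet]

end Simplex

/-! ### Contraction with several vectors -/

section FiberVec

variable {V : Type}

/-- The tuple `(w (k-1), …, w 0, v 0, …, v (p-1))`. -/
def fiberVec {k n p : ℕ} (h : p + k = n) (w : Fin k → V) (v : Fin p → V) (i : Fin n) : V :=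
  if hi : (i : ℕ) < k then w ⟨k - 1 - i, by omega⟩ else v ⟨i - k, by omega⟩

theorem fiberVec_of_lt {k n p : ℕ} (h : p + k = n) (w : Fin k → V) (v : Fin p → V) {i : ℕ}
    (hn : i < n) (hi : i < k) : fiberVec h w v ⟨i, hn⟩ = w ⟨k - 1 - i, by omega⟩ := dif_pos hi

theorem fiberVec_of_le {k n p : ℕ} (h : p + k = n) (w : Fin k → V) (v : Fin p → V) {i : ℕ}
    (hn : i < n) (hi : k ≤ i) : fiberVec h w v ⟨i, hn⟩ = v ⟨i - k, by omega⟩ :=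
  dif_neg (not_lt.2 hi)

theorem comp_fiberVec {V' : Type} {k n p : ℕ} (h : p + k = n) (f : V → V') (w : Fin k → V)
    (v : Fin p → V) : f ∘ fiberVec h w v = fiberVec h (f ∘ w) (f ∘ v) := by
  funext i
  simp only [Function.comp_apply, fiberVec]
  split_ifs <;> rfl

theorem fiberVec_succ {k n p : ℕ} (h : p + k = n) (h' : p + (k + 1) = n + 1) (w : Fin (k + 1) → V)
    (v : Fin p → V) : fiberVec h' w v =
      (Fin.cons (w (Fin.last k)) (fiberVec h (fun i => w i.castSucc) v) : Fin (n + 1) → V) := by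
  funext i
  induction i using Fin.cases with
  | zero => exact fiberVec_of_lt h' w v (i := 0) _ (by omega)
  | succ i =>
    obtain ⟨i, hi⟩ := i
    rw [Fin.cons_succ]
    rcases lt_or_ge i k with hik | hik
    · rw [fiberVec_of_lt h _ v hi hik, Fin.succ_mk, fiberVec_of_lt h' w v _ (by omega)]
      congr 1
      ext
      simp
      omega
    · rw [fiberVec_of_le h _ v hi hik, Fin.succ_mk, fiberVec_of_le h' w v _ (by omega)]
      congr 1
      ext
      simp

theorem removeNth_fiberVec_vertical {k n p : ℕ} (h : p + k = n) (h' : p + (k + 1) = n + 1)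
    (w : Fin (k + 1) → V) (v : Fin p → V) (j : Fin (k + 1)) :
    Fin.removeNth ⟨k - j, by omega⟩ (fiberVec h' w v) = fiberVec h (j.removeNth w) v := by
  obtain ⟨j, hj⟩ := j
  funext ⟨i, hi⟩
  simp only [Fin.removeNth, fiberVec, Fin.succAbove, Fin.lt_def, Fin.val_castSucc]
  rcases lt_or_ge i (k - j) with h1 | h1 <;> rcases lt_or_ge i k with h2 | h2
  · have h3 : i < k + 1 := by omega
    have h4 : ¬ (k - 1 - i < j) := by omega
    simp only [h1, h2, h3, h4, if_true, if_false, dif_pos, Fin.val_castSucc]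
    congr 1
    ext
    simp
    omega
  · omega
  · have h3 : i + 1 < k + 1 := by omega
    have h4 : k - 1 - i < j := by omega
    simp only [not_lt.2 h1, h2, h3, h4, if_true, if_false, dif_pos, Fin.val_succ]
    congr 1
    ext
    simp
    omega
  · have h3 : ¬ (i + 1 < k + 1) := by omega
    simp only [not_lt.2 h1, not_lt.2 h2, h3, if_false, Fin.val_succ, dite_false]
    congr 1
    ext
    simp

theorem removeNth_fiberVec_horizontal {k n p : ℕ} (h : p + k = n) (h' : p + 1 + k = n + 1)
    (w : Fin k → V) (v : Fin (p + 1) → V) (l : Fin (p + 1)) :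
    Fin.removeNth ⟨k + l, by omega⟩ (fiberVec h' w v) = fiberVec h w (l.removeNth v) := by
  obtain ⟨l, hl⟩ := l
  funext ⟨i, hi⟩
  simp only [Fin.removeNth, fiberVec, Fin.succAbove, Fin.lt_def, Fin.val_castSucc]
  rcases lt_or_ge i (k + l) with h1 | h1 <;> rcases lt_or_ge i k with h2 | h2
  · simp [h1, h2]
  · have h3 : i - k < l := by omega
    simp only [h1, not_lt.2 h2, h3, if_true, dite_false, Fin.val_castSucc]
    rfl
  · omega
  · have h3 : ¬ (i - k < l) := by omega
    have h4 : ¬ (i + 1 < k) := by omega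
    simp only [not_lt.2 h1, not_lt.2 h2, h3, h4, if_false, dite_false, Fin.val_succ]
    congr 1
    ext
    simp
    omega

theorem sum_fin_split {a b N : ℕ} (h : a + b = N) (f : Fin N → ℝ) :
    ∑ i, f i = ∑ i : Fin a, f ⟨i, by omega⟩ + ∑ l : Fin b, f ⟨a + l, by omega⟩ := by
  subst h
  exact Fin.sum_univ_add f

end FiberVec

section Alternating

variable {V : Type} [NormedAddCommGroup V] [NormedSpace ℝ V]

/-- Each contraction fills the first slot, and the last vector is contracted first; hence the
reversed order in `fiberVec`. -/
theorem contract_recast {k n p : ℕ} (h : p + k = n) (w : Fin k → V) (φ : V [⋀^Fin n]→L[ℝ] ℝ)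
    (v : Fin p → V) : contract k w (recast h φ) v = φ (fiberVec h w v) := by
  subst h
  change contract k w φ v = _
  induction k with
  | zero =>
    change φ v = _
    congr 1
  | succ k ih =>
    change contract k _ _ v = _
    rw [ih]
    change φ (Fin.cons _ _) = _
    congr 1
    exact (fiberVec_succ rfl rfl w v).symm

theorem neg_one_pow_sub {j k : ℕ} (h : j ≤ k) : (-1 : ℝ) ^ (k - j) = (-1) ^ k * (-1) ^ j := by
  obtain ⟨m, rfl⟩ := Nat.exists_eq_add_of_le h
  rw [Nat.add_sub_cancel_left, pow_add, mul_right_comm, ← pow_add, ← two_mul, pow_mul]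
  simp

/-- The expansion of an alternatized sum over a tuple of vertical and horizontal vectors. -/
theorem alternatizeUncurryFin_fiberVec {k n p : ℕ} (h : p + k = n) (h' : p + (k + 1) = n + 1)
    (A : V →L[ℝ] V [⋀^Fin n]→L[ℝ] ℝ) (w : Fin (k + 1) → V) (v : Fin p → V) :
    ContinuousAlternatingMap.alternatizeUncurryFin A (fiberVec h' w v) =
      (-1) ^ k * ∑ j : Fin (k + 1), (-1) ^ (j : ℕ) * A (w j) (fiberVec h (j.removeNth w) v) +
        (-1) ^ (k + 1) * ∑ l : Fin p, (-1) ^ (l : ℕ) * A (v l)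
          (Fin.removeNth ⟨k + 1 + l, by omega⟩ (fiberVec h' w v)) := by
  -- The first `k + 1` slots hold the `w j` backwards, with `w j` in slot `k - j`. Reversing that
  -- sum turns its sign into `(-1)^k (-1)^j`.
  rw [ContinuousAlternatingMap.alternatizeUncurryFin_apply, sum_fin_split (a := k + 1) (b := p)
    (by omega), ← Equiv.sum_comp Fin.revPerm]
  congr 1
  · rw [Finset.mul_sum]
    refine Finset.sum_congr rfl fun j _ => ?_
    have e : (⟨(Fin.revPerm j : Fin (k + 1)), by omega⟩ : Fin (n + 1)) = ⟨k - j, by omega⟩ := by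
      ext
      simp
    have e' : fiberVec h' w v ⟨k - j, by omega⟩ = w j := by
      rw [fiberVec_of_lt h' w v _ (by omega)]
      congr 1
      ext
      simp
      omega
    rw [e, removeNth_fiberVec_vertical h h' w v j, e', zsmul_eq_mul]
    push_cast
    rw [neg_one_pow_sub (by omega : (j : ℕ) ≤ k), mul_assoc]
  · rw [Finset.mul_sum]
    refine Finset.sum_congr rfl fun l _ => ?_
    have e' : fiberVec h' w v ⟨k + 1 + l, by omega⟩ = v l := by
      rw [fiberVec_of_le h' w v _ (by omega)]
      congr 1
      ext
      simp
    rw [e', zsmul_eq_mul]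
    push_cast
    rw [pow_add, mul_assoc]

/-- A row operation: multiples of entry `a` are added to the other entries, one at a time by
induction on the set of entries changed, and each added term has a repeated argument. -/
theorem map_add_smul_row {N : ℕ} (Φ : V [⋀^Fin N]→L[ℝ] ℝ) (X : Fin N → V) (a : Fin N)
    (c : Fin N → ℝ) (hc : c a = 0) : Φ (fun i => X i + c i • X a) = Φ X := by
  classical
  have key : ∀ s : Finset (Fin N), a ∉ s →
      Φ (fun i => if i ∈ s then X i + c i • X a else X i) = Φ X := by
    intro s
    induction s using Finset.induction_on with
    | empty => simp
    | insert b s hb ih =>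
      intro ha
      rw [Finset.mem_insert, not_or] at ha
      set Y : Fin N → V := fun i => if i ∈ s then X i + c i • X a else X i with hY
      have hYa : Y a = X a := by simp [hY, ha.2]
      have hYb : Y b = X b := by simp [hY, hb]
      have e : (fun i => if i ∈ insert b s then X i + c i • X a else X i) =
          Function.update Y b (X b + c b • X a) := by
        funext i
        rcases eq_or_ne i b with rfl | hi
        · simp
        · simp [hY, hi, Finset.mem_insert]
      rw [e, ContinuousAlternatingMap.map_update_add, ContinuousAlternatingMap.map_update_smul,
        ← hYb, Function.update_eq_self, ← hYa,
        Φ.map_eq_zero_of_eq (Function.update Y b (Y a)) (i := a) (j := b)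
          (by rw [Function.update_self, Function.update_of_ne ha.1]) ha.1, smul_zero, add_zero]
      exact ih ha.2
  rw [← key (Finset.univ.erase a) (by simp)]
  congr 1
  funext i
  rcases eq_or_ne i a with rfl | hi
  · simp [hc]
  · simp [hi]

/-- The value of an alternating form on the edges `w 1 - w 0, …, w k - w 0` of a simplex whose
vertices lie on an affine hyperplane. -/
theorem sum_removeNth_fiberVec {k n p : ℕ} (h : p + k = n) (φ : V [⋀^Fin n]→L[ℝ] ℝ)
    (w : Fin (k + 1) → V) (v : Fin p → V) (f : V →L[ℝ] ℝ) (hw : ∀ j, f (w j) = 1)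
    (hv : ∀ l, f (v l) = 0) :
    ∑ j : Fin (k + 1), (-1) ^ (j : ℕ) * φ (fiberVec h (j.removeNth w) v) =
      φ (fiberVec h (fun i => w i.succ - w 0) v) := by
  have h' : p + (k + 1) = n + 1 := by omega
  -- Its alternatization is the wedge product of `f` and `φ`. On the vectors `w j` and `v l`, where
  -- `f` is `1` and `0`, its expansion is the left side up to `(-1)^k`.
  let A : V →L[ℝ] V [⋀^Fin n]→L[ℝ] ℝ := f.smulRight φ
  have hA : ∀ x y, A x y = f x * φ y := fun x y => rfl
  -- A row operation takes `w` to `w'`, so the wedge product does not change. On `w'` only the first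
  -- vector pairs nontrivially with `f`, and a single term survives.
  let w' : Fin (k + 1) → V := Fin.cons (w 0) fun i => w i.succ - w 0
  have hw' : ∀ j : Fin k, f (w' j.succ) = 0 := fun j => by simp [w', hw]
  have h1 := alternatizeUncurryFin_fiberVec h h' A w v
  have h2 := alternatizeUncurryFin_fiberVec h h' A w' v
  have h3 : fiberVec h' w' v = fun i => fiberVec h' w v i +
      (if (i : ℕ) < k then (-1 : ℝ) else 0) • fiberVec h' w v ⟨k, by omega⟩ := by
    have e0 : fiberVec h' w v ⟨k, by omega⟩ = w 0 := by
      rw [fiberVec_of_lt h' w v _ (by omega)]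
      congr 1
      ext
      simp
    rw [e0]
    funext ⟨i, hi⟩
    rcases lt_trichotomy i k with hik | rfl | hik
    · rw [fiberVec_of_lt h' w v _ (by omega), fiberVec_of_lt h' w' v _ (by omega)]
      have e : (⟨k + 1 - 1 - i, by omega⟩ : Fin (k + 1)) = Fin.succ ⟨k - 1 - i, by omega⟩ := by
        ext
        simp
        omega
      rw [e, if_pos hik]
      simp only [w', Fin.cons_succ, neg_smul, one_smul, sub_eq_add_neg]
    · rw [e0, fiberVec_of_lt h' w' v _ (by omega)]
      have e : (⟨i + 1 - 1 - i, by omega⟩ : Fin (i + 1)) = 0 := by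
        ext
        simp
      rw [e]
      simp [w']
    · rw [fiberVec_of_le h' w v _ (by omega), fiberVec_of_le h' w' v _ (by omega)]
      simp [hik.le]
  rw [h3, map_add_smul_row _ _ _ _ (by simp), h1] at h2
  simp only [hA, hw, hv, one_mul, zero_mul, mul_zero, Finset.sum_const_zero, add_zero] at h2
  have h4 := mul_left_cancel₀ (pow_ne_zero k (by norm_num : (-1 : ℝ) ≠ 0)) h2
  rw [h4, Fin.sum_univ_succ]
  simp only [hw', zero_mul, mul_zero, Finset.sum_const_zero, add_zero]
  have e : Fin.removeNth 0 w' = fun i => w i.succ - w 0 := by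
    funext i
    simp [Fin.removeNth, w']
  rw [e]
  simp [w', hw]

end Alternating

/-! ### The fibre integral as a smooth form -/

section FiberForm

open MeasureTheory

/-- The coordinate vector fields `∂/∂t₁, …, ∂/∂t_k` on `U × Δ^k`. -/
def vert (U : CartSp) (k : ℕ) (i : Fin k) : U.Space × (Fin k → ℝ) := (0, Pi.single i 1)

/-- Contraction is packaged as a continuous linear map so that it commutes with integrals and
derivatives; it is a composite of currying and evaluation maps, by induction on `k`. -/
theorem exists_contractCLM {W W' : Type} [NormedAddCommGroup W] [NormedSpace ℝ W]
    [NormedAddCommGroup W'] [NormedSpace ℝ W'] {k n p : ℕ} (h : p + k = n) (w : Fin k → W)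
    (f : W' →L[ℝ] W) : ∃ L : (W [⋀^Fin n]→L[ℝ] ℝ) →L[ℝ] (W' [⋀^Fin p]→L[ℝ] ℝ),
      ∀ φ, L φ = (contract k w (recast h φ)).compContinuousLinearMap f := by
  subst h
  induction k with
  | zero => exact ⟨ContinuousAlternatingMap.compContinuousLinearMapCLM f, fun φ => rfl⟩
  | succ k ih =>
    obtain ⟨L, hL⟩ := ih fun i => w i.castSucc
    exact ⟨L ∘L (ContinuousLinearMap.apply ℝ _ (w (Fin.last k))) ∘L
      (ContinuousAlternatingMap.curryLeftLI (𝕜 := ℝ) (E := W) (F := ℝ)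
        (n := p + k)).toContinuousLinearMap, fun φ => hL _⟩

/-- Contraction with the coordinate vector fields of the simplex, followed by restriction to the
vectors tangent to `U`, as a continuous linear map. -/
def fiberContract (U : CartSp) {k n p : ℕ} (h : p + k = n) :
    ((U.Space × (Fin k → ℝ)) [⋀^Fin n]→L[ℝ] ℝ) →L[ℝ] (U.Space [⋀^Fin p]→L[ℝ] ℝ) :=
  (exists_contractCLM h (vert U k) (.inl ℝ U.Space (Fin k → ℝ))).choose

theorem fiberContract_eq (U : CartSp) {k n p : ℕ} (h : p + k = n)
    (φ : (U.Space × (Fin k → ℝ)) [⋀^Fin n]→L[ℝ] ℝ) : fiberContract U h φ =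
      (contract k (vert U k) (recast h φ)).compContinuousLinearMap (.inl ℝ U.Space (Fin k → ℝ)) :=
  (exists_contractCLM h (vert U k) (.inl ℝ U.Space (Fin k → ℝ))).choose_spec φ

/-- The vectors `(∂/∂t_k, …, ∂/∂t₁, v₁, …, v_p)`. -/
def frame (U : CartSp) {k n p : ℕ} (h : p + k = n) (v : Fin p → U.Space) :
    Fin n → U.Space × (Fin k → ℝ) := fiberVec h (vert U k) fun l => (v l, 0)

theorem fiberContract_apply (U : CartSp) {k n p : ℕ} (h : p + k = n)
    (φ : (U.Space × (Fin k → ℝ)) [⋀^Fin n]→L[ℝ] ℝ) (v : Fin p → U.Space) :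
    fiberContract U h φ v = φ (frame U h v) := by
  rw [fiberContract_eq, ContinuousAlternatingMap.compContinuousLinearMap_apply, contract_recast]
  rfl

variable {U : CartSp} {k n p : ℕ}

theorem fiberIntegral_eq (h : p + k = n) (α : Form (tube U k) n) (u : U.Space) :
    fiberIntegral h α u = ∫ t in simplex k, fiberContract U h (α.1 (u, t)) := by
  simp only [fiberContract_eq]
  rfl

theorem continuousOn_fiberContract (h : p + k = n) (α : Form (tube U k) n) (u : U.Space) :
    ContinuousOn (fun t => fiberContract U h (α.1 (u, t))) (simplex k) :=
  continuousOn_slice (g := fun x => fiberContract U h (α.1 x))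
    ((fiberContract U h).continuous.comp_continuousOn α.2.1.continuousOn) u

theorem fiberIntegral_apply (h : p + k = n) (α : Form (tube U k) n) (u : U.Space)
    (v : Fin p → U.Space) :
    fiberIntegral h α u v = ∫ t in simplex k, α.1 (u, t) (frame U h v) := by
  have hi : Integrable (fun t => fiberContract U h (α.1 (u, t))) (volume.restrict (simplex k)) :=
    (continuousOn_fiberContract h α u).integrableOn_compact (isCompact_simplex k)
  have e := (ContinuousAlternatingMap.apply ℝ U.Space ℝ v).integral_comp_comm hi
  rw [fiberIntegral_eq]
  refine e.symm.trans ?_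
  congr 1
  funext t
  exact fiberContract_apply U h _ v

theorem contDiff_fiberIntegral (h : p + k = n) (α : Form (tube U k) n) :
    ContDiff ℝ ∞ (fiberIntegral h α) := by
  have e : fiberIntegral h α = fun u => ∫ t in simplex k, fiberContract U h (α.1 (u, t)) :=
    funext fun u => fiberIntegral_eq h α u
  rw [e]
  exact contDiff_setIntegral (isCompact_simplex k) (isBody_tube U k).uniqueDiffOn
    (g := fun x => fiberContract U h (α.1 x))
    ((fiberContract U h).contDiff.comp_contDiffOn α.2.1)

theorem continuousOn_fderivWithin_slice (α : Form (tube U k) n) (u : U.Space)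
    (y : U.Space × (Fin k → ℝ)) (X : Fin n → U.Space × (Fin k → ℝ)) :
    ContinuousOn (fun t => fderivWithin ℝ α.1 (tube U k) (u, t) y X) (simplex k) := by
  have h := α.2.1.continuousOn_fderivWithin (isBody_tube U k).uniqueDiffOn (by simp)
  exact continuousOn_slice (g := fun x => fderivWithin ℝ α.1 (tube U k) x y X)
    ((ContinuousAlternatingMap.apply ℝ _ ℝ X).continuous.comp_continuousOn
      (h.clm_apply continuousOn_const)) u

theorem fderiv_fiberIntegral_apply (h : p + k = n) (α : Form (tube U k) n) (u y : U.Space)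
    (v : Fin p → U.Space) : fderiv ℝ (fiberIntegral h α) u y v =
      ∫ t in simplex k, fderivWithin ℝ α.1 (tube U k) (u, t) (y, 0) (frame U h v) := by
  have e : fiberIntegral h α = fun u => ∫ t in simplex k, fiberContract U h (α.1 (u, t)) :=
    funext fun u => fiberIntegral_eq h α u
  have hS := (isBody_tube U k).uniqueDiffOn
  have hg : ContDiffOn ℝ ∞ (fun x => fiberContract U h (α.1 x)) (tube U k) :=
    (fiberContract U h).contDiff.comp_contDiffOn α.2.1
  have e' := fderiv_setIntegral_apply (μ := volume) (isCompact_simplex k) hS hg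
    (ContinuousAlternatingMap.apply ℝ U.Space ℝ v) u y
  rw [e]
  refine e'.trans (setIntegral_congr_fun (measurableSet_simplex k) fun t ht => ?_)
  have hx : (u, t) ∈ tube U k := ⟨Set.mem_univ _, ht⟩
  have hda := ((fiberContract U h).hasFDerivAt.comp_hasFDerivWithinAt (u, t)
    (α.2.1.differentiableOn (by simp) (u, t) hx).hasFDerivWithinAt).fderivWithin (hS _ hx)
  change (fderivWithin ℝ (fun x => fiberContract U h (α.1 x)) (tube U k) (u, t)) (y, 0) v = _
  refine (congrArg (fun D => D (y, (0 : Fin k → ℝ)) v) hda).trans ?_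
  exact fiberContract_apply U h _ v

/-- The fibre integral of forms of degree `n = p + k` on `U × Δ^k`, a linear map to the forms of
degree `p` on `U`. -/
def fiberForm (U : CartSp) (h : p + k = n) : Form (tube U k) n →ₗ[ℝ] Omega p U where
  toFun α := Form.of (fiberIntegral h α) (contDiff_fiberIntegral h α).contDiffOn
    fun x hx => absurd (Set.mem_univ x) hx
  map_add' α β := by
    apply Form.ext
    intro u _
    have hi := fun α : Form (tube U k) n =>
      (continuousOn_fiberContract h α u).integrableOn_compact (isCompact_simplex k) (μ := volume)
    change fiberIntegral h (α + β) u = fiberIntegral h α u + fiberIntegral h β u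
    simp only [fiberIntegral_eq, Form.add_val, Pi.add_apply, map_add]
    exact integral_add (hi α) (hi β)
  map_smul' c α := by
    apply Form.ext
    intro u _
    change fiberIntegral h (c • α) u = c • fiberIntegral h α u
    simp only [fiberIntegral_eq, Form.smul_val, Pi.smul_apply, map_smul]
    exact integral_smul c _

@[simp] theorem fiberForm_val (h : p + k = n) (α : Form (tube U k) n) :
    (fiberForm U h α).1 = fiberIntegral h α := rfl

theorem fiberForm_eq_zero (h : p + k = n) (α : Form (tube U k) n)
    (h0 : ∀ u, ∀ t ∈ simplex k, ∀ v : Fin p → U.Space, α.1 (u, t) (frame U h v) = 0) :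
    fiberForm U h α = 0 := by
  apply Form.ext
  intro u _
  ext v
  change fiberIntegral h α u v = 0
  rw [fiberIntegral_apply]
  exact setIntegral_eq_zero_of_forall_eq_zero fun t ht => h0 u t ht v

theorem extD_apply_vec {S : Set (U.Space × (Fin k → ℝ))} (hS : IsBody S) (α : Form S n)
    {x : U.Space × (Fin k → ℝ)} (hx : x ∈ S) (X : Fin (n + 1) → U.Space × (Fin k → ℝ)) :
    (extD hS n α).1 x X =
      ContinuousAlternatingMap.alternatizeUncurryFin (fderivWithin ℝ α.1 S x) X :=
  congrArg (fun φ => φ X) (extD_apply hS α hx)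

theorem dR_fiberForm_apply (h : p + k = n) (α : Form (tube U k) n) (u : U.Space)
    (v : Fin (p + 1) → U.Space) : (dR p U (fiberForm U h α)).1 u v =
      ∑ l : Fin (p + 1), (-1) ^ (l : ℕ) * ∫ t in simplex k,
        fderivWithin ℝ α.1 (tube U k) (u, t) (v l, 0) (frame U h (l.removeNth v)) := by
  have e := congrArg (fun φ => φ v) (extD_apply isBody_univ (fiberForm U h α) (Set.mem_univ u))
  refine e.trans ?_
  change ContinuousAlternatingMap.alternatizeUncurryFin
    (fderivWithin ℝ (fiberIntegral h α) Set.univ u) v = _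
  rw [ContinuousAlternatingMap.alternatizeUncurryFin_apply, fderivWithin_univ]
  refine Finset.sum_congr rfl fun l _ => ?_
  rw [fderiv_fiberIntegral_apply, zsmul_eq_mul]
  push_cast
  rfl

end FiberForm

/-! ### Stokes' theorem for the fibre integral -/

section Stokes

open MeasureTheory

/-- The vertices `0, e₁, …, e_k` of the standard simplex. -/
def vertex {k : ℕ} (a : Fin (k + 1)) : Fin k → ℝ := fun l => if a = l.succ then 1 else 0

theorem vertex_zero {k : ℕ} : vertex (0 : Fin (k + 1)) = 0 := by
  funext l
  simp [vertex, (Fin.succ_ne_zero l).symm]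

theorem vertex_succ {k : ℕ} (i : Fin k) : vertex i.succ = Pi.single i 1 := by
  funext l
  simp [vertex, Pi.single_apply, eq_comm]

theorem fderiv_simplexMap_single {k l : ℕ} (θ : Fin (k + 1) → Fin (l + 1)) (t : Fin k → ℝ)
    (i : Fin k) : fderiv ℝ (simplexMap θ) t (Pi.single i 1) = vertex (θ i.succ) - vertex (θ 0) := by
  funext j
  rw [fderiv_simplexMap, Finset.sum_filter, Fin.sum_univ_succ]
  simp only [Fin.cons_zero, Fin.cons_succ, Pi.sub_apply, vertex, Pi.single_apply]
  have h : ∑ b : Fin k, (if θ b.succ = j.succ then if b = i then (1 : ℝ) else 0 else 0) =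
      if θ i.succ = j.succ then 1 else 0 := by
    rw [Finset.sum_eq_single i]
    · simp
    · intro b _ hb
      simp [hb]
    · simp
  rw [h]
  simp
  split_ifs <;> ring

variable {U : CartSp} {k n p : ℕ}

/-- An affine map of simplices sends `∂/∂t_i` to the edge from the image of the vertex `0` to the
image of the vertex `i`. Faces and degeneracies are both treated through this formula. -/
theorem cellMap_frame {a b : SimplexCategory} (h : p + a.len = n) (θ : a ⟶ b)
    (α : Form (tube U b.len) n) (u : U.Space) {s : Fin a.len → ℝ} (hs : s ∈ simplex a.len)
    (v : Fin p → U.Space) : (cellMap n (𝟙 U) θ α).1 (u, s) (frame U h v) =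
      α.1 (u, simplexMap θ.toOrderHom s) (fiberVec h (fun i => ((0 : U.Space),
        vertex (θ.toOrderHom i.succ) - vertex (θ.toOrderHom 0))) fun l => (v l, 0)) := by
  have hx : (u, s) ∈ tube U a.len := ⟨Set.mem_univ _, hs⟩
  refine (congrArg (fun φ => φ (frame U h v)) (cellMap_apply (𝟙 U) θ α hx)).trans ?_
  change α.1 (u, simplexMap θ.toOrderHom s)
    (((fderiv ℝ id u).prodMap (fderiv ℝ (simplexMap θ.toOrderHom) s)) ∘ frame U h v) = _
  rw [frame, comp_fiberVec]
  congr 2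
  · funext i
    simp [vert, fderiv_simplexMap_single]
  · funext l
    simp

/-- The slanted face has vertices `e₁, …, e_(k+1)`, so its edges at the first vertex are differences
of coordinate vectors. -/
theorem face_zero_frame (h : p + k = n) (α : Form (tube U (k + 1)) n) (u : U.Space)
    {s : Fin k → ℝ} (hs : s ∈ simplex k) (v : Fin p → U.Space) :
    (cellMap n (𝟙 U) (SimplexCategory.δ (0 : Fin (k + 2))) α).1 (u, s) (frame U h v) =
      α.1 (u, simplexMap Fin.succ s)
        (fiberVec h (fun i => vert U (k + 1) i.succ - vert U (k + 1) 0) fun l => (v l, 0)) := by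
  refine (cellMap_frame h (SimplexCategory.δ (0 : Fin (k + 2))) α u hs v).trans ?_
  have e : ⇑(SimplexCategory.δ (0 : Fin (k + 2))).toOrderHom = Fin.succ :=
    funext fun i => Fin.succAbove_zero_apply i
  have e' : (fun i : Fin k => ((0 : U.Space),
      vertex ((SimplexCategory.δ (0 : Fin (k + 2))).toOrderHom i.succ) -
        vertex ((SimplexCategory.δ (0 : Fin (k + 2))).toOrderHom 0))) =
      fun i => vert U (k + 1) i.succ - vert U (k + 1) 0 := by
    funext i
    rw [e]
    refine Prod.ext (sub_zero (0 : U.Space)).symm ?_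
    change vertex i.succ.succ - vertex (Fin.succ 0) = _
    rw [vertex_succ, vertex_succ]
    rfl
  exact congrArg₂ (fun θ w => α.1 (u, simplexMap θ s) (fiberVec h w fun l => (v l, 0))) e e'

/-- A coordinate face keeps the vertex `0`, so its edges are the coordinate vectors other than the
`j`-th. -/
theorem face_succ_frame (h : p + k = n) (α : Form (tube U (k + 1)) n) (u : U.Space)
    (j : Fin (k + 1)) {s : Fin k → ℝ} (hs : s ∈ simplex k) (v : Fin p → U.Space) :
    (cellMap n (𝟙 U) (SimplexCategory.δ j.succ) α).1 (u, s) (frame U h v) =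
      α.1 (u, simplexMap j.succ.succAbove s)
        (fiberVec h (j.removeNth (vert U (k + 1))) fun l => (v l, 0)) := by
  refine (cellMap_frame h (SimplexCategory.δ j.succ) α u hs v).trans ?_
  have e' : (fun i : Fin k => ((0 : U.Space),
      vertex ((SimplexCategory.δ j.succ).toOrderHom i.succ) -
        vertex ((SimplexCategory.δ j.succ).toOrderHom 0))) = j.removeNth (vert U (k + 1)) := by
    funext i
    refine Prod.ext rfl ?_
    change vertex (j.succ.succAbove i.succ) - vertex (j.succ.succAbove 0) =
      Pi.single (j.succAbove i) 1
    rw [Fin.succ_succAbove_succ, Fin.succ_succAbove_zero, vertex_succ, vertex_zero, sub_zero]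
  exact congrArg (fun w => α.1 (u, simplexMap j.succ.succAbove s)
    (fiberVec h w fun l => (v l, 0))) e'

theorem contDiffOn_slice_apply (α : Form (tube U k) n) (u : U.Space)
    (X : Fin n → U.Space × (Fin k → ℝ)) :
    ContDiffOn ℝ ∞ (fun t => α.1 (u, t) X) (simplex k) :=
  ((ContinuousAlternatingMap.apply ℝ _ ℝ X).contDiff.comp_contDiffOn α.2.1).comp
    (contDiff_prodMk_right u).contDiffOn fun _ ht => ⟨Set.mem_univ _, ht⟩

theorem integrableOn_slice_apply {l : ℕ} (α : Form (tube U k) n) (u : U.Space)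
    (X : Fin n → U.Space × (Fin k → ℝ)) (θ : Fin (l + 1) → Fin (k + 1)) :
    IntegrableOn (fun s => α.1 (u, simplexMap θ s) X) (simplex l) :=
  ((contDiffOn_slice_apply α u X).continuousOn.comp (contDiff_simplexMap θ).continuous.continuousOn
    (simplexMap_mapsTo θ)).integrableOn_compact (isCompact_simplex l)

theorem integral_fderivWithin_vert (α : Form (tube U (k + 1)) n) (u : U.Space) (j : Fin (k + 1))
    (X : Fin n → U.Space × (Fin (k + 1) → ℝ)) :
    ∫ t in simplex (k + 1), fderivWithin ℝ α.1 (tube U (k + 1)) (u, t) (vert U (k + 1) j) X =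
      (∫ s in simplex k, α.1 (u, simplexMap Fin.succ s) X) -
        ∫ s in simplex k, α.1 (u, simplexMap j.succ.succAbove s) X := by
  have hg := contDiffOn_slice_apply α u X
  have h1 : ∫ t in simplex (k + 1), fderivWithin ℝ α.1 (tube U (k + 1)) (u, t)
      (vert U (k + 1) j) X = ∫ t in simplex (k + 1),
        fderivWithin ℝ (fun t => α.1 (u, t) X) (simplex (k + 1)) t (Pi.single j 1) := by
    refine setIntegral_congr_fun (measurableSet_simplex _) fun t ht => ?_
    have hx : (u, t) ∈ tube U (k + 1) := ⟨Set.mem_univ _, ht⟩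
    have hd := (α.2.1.differentiableOn (by simp) (u, t) hx).hasFDerivWithinAt
    have hc := hd.comp (s := simplex (k + 1)) t (hasFDerivAt_prodMk_right u t).hasFDerivWithinAt
      fun _ ht => ⟨Set.mem_univ _, ht⟩
    have he := ((ContinuousAlternatingMap.apply ℝ _ ℝ X).hasFDerivAt.comp_hasFDerivWithinAt t
      hc).fderivWithin ((isBody_simplex _).uniqueDiffOn t ht)
    exact (congrArg (fun D => D (Pi.single j 1)) he).symm
  -- This makes the parametrization of the slanted face the same for all `j`, as the later summation
  -- over `j` requires.
  have h2 := integral_simplexMap_perm j.cycleRange.symm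
    fun s => α.1 (u, simplexMap Fin.succ s) X
  rw [h1, integral_simplex_fderivWithin j (hg.of_le (by simp)), ← h2, ← integral_sub]
  · refine setIntegral_congr_fun (measurableSet_simplex k) fun s _ => ?_
    rw [insertNth_eq_simplexMap, insertNth_zero_eq_simplexMap, simplexMap_comp]
    rfl
  · refine (integrableOn_slice_apply α u X (Fin.succ ∘ j.cycleRange.symm)).congr_fun ?_
      (measurableSet_simplex k)
    intro s _
    change α.1 (u, simplexMap (Fin.succ ∘ j.cycleRange.symm) s) X = _
    rw [simplexMap_comp]
    rfl
  · exact integrableOn_slice_apply α u X _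

/-- Stokes' theorem on the simplices of a tube. -/
theorem integral_extD (h : p + k = n) (h' : p + (k + 1) = n + 1) (α : Form (tube U (k + 1)) n)
    (u : U.Space) (v : Fin p → U.Space) :
    ∫ t in simplex (k + 1), (extD (isBody_tube U (k + 1)) n α).1 (u, t) (frame U h' v) =
      (-1) ^ k * ∑ i : Fin (k + 2), (-1) ^ (i : ℕ) * (∫ s in simplex k,
          (cellMap n (𝟙 U) (SimplexCategory.δ i) α).1 (u, s) (frame U h v)) +
        (-1) ^ (k + 1) * ∑ l : Fin p, (-1) ^ (l : ℕ) * ∫ t in simplex (k + 1),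
          fderivWithin ℝ α.1 (tube U (k + 1)) (u, t) (v l, 0)
            (Fin.removeNth ⟨k + 1 + l, by omega⟩ (frame U h' v)) := by
  have hint := fun (y : U.Space × (Fin (k + 1) → ℝ)) X =>
    (continuousOn_fderivWithin_slice α u y X).integrableOn_compact (μ := volume)
      (isCompact_simplex (k + 1))
  let X : Fin (k + 1) → Fin n → U.Space × (Fin (k + 1) → ℝ) := fun j =>
    fiberVec h (j.removeNth (vert U (k + 1))) fun l => (v l, 0)
  have h1 : ∫ t in simplex (k + 1), (extD (isBody_tube U (k + 1)) n α).1 (u, t) (frame U h' v) =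
      ∫ t in simplex (k + 1), ((-1) ^ k * ∑ j : Fin (k + 1), (-1) ^ (j : ℕ) *
          fderivWithin ℝ α.1 (tube U (k + 1)) (u, t) (vert U (k + 1) j) (X j) +
        (-1) ^ (k + 1) * ∑ l : Fin p, (-1) ^ (l : ℕ) *
          fderivWithin ℝ α.1 (tube U (k + 1)) (u, t) (v l, 0)
            (Fin.removeNth ⟨k + 1 + l, by omega⟩ (frame U h' v))) := by
    refine setIntegral_congr_fun (measurableSet_simplex _) fun t ht => ?_
    exact (extD_apply_vec (isBody_tube U (k + 1)) α (x := (u, t)) ⟨Set.mem_univ _, ht⟩ _).trans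
      (alternatizeUncurryFin_fiberVec h h' _ _ _)
  -- The slanted contributions combine into the face `∂₀`. The functional is the sum of the simplex
  -- coordinates, which is `1` on each `∂/∂t_j` and `0` on vectors tangent to `U`.
  have h2 : ∑ j : Fin (k + 1), (-1) ^ (j : ℕ) *
      ∫ s in simplex k, α.1 (u, simplexMap Fin.succ s) (X j) =
      ∫ s in simplex k,
        (cellMap n (𝟙 U) (SimplexCategory.δ (0 : Fin (k + 2))) α).1 (u, s) (frame U h v) := by
    simp only [← integral_const_mul]
    rw [← integral_finsetSum _ fun j _ => (integrableOn_slice_apply α u (X j) Fin.succ).const_mul _]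
    refine setIntegral_congr_fun (measurableSet_simplex k) fun s hs => ?_
    rw [face_zero_frame h α u hs v]
    refine sum_removeNth_fiberVec h _ (vert U (k + 1)) _
      ((∑ i, ContinuousLinearMap.proj i : (Fin (k + 1) → ℝ) →L[ℝ] ℝ) ∘L
        ContinuousLinearMap.snd ℝ U.Space (Fin (k + 1) → ℝ)) (fun j => ?_) fun l => ?_
    · simp [vert]
    · simp
  rw [h1, integral_add, integral_const_mul, integral_const_mul, integral_finsetSum,
    integral_finsetSum]
  · simp only [integral_const_mul, integral_fderivWithin_vert, mul_sub, Finset.sum_sub_distrib]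
    rw [h2, Fin.sum_univ_succ (n := k + 1)]
    have h3 : ∀ j : Fin (k + 1), ∫ s in simplex k,
        (cellMap n (𝟙 U) (SimplexCategory.δ j.succ) α).1 (u, s) (frame U h v) =
        ∫ s in simplex k, α.1 (u, simplexMap j.succ.succAbove s) (X j) := fun j =>
      setIntegral_congr_fun (measurableSet_simplex k) fun s hs => face_succ_frame h α u j hs v
    simp only [h3, Fin.val_zero, pow_zero, one_mul, Fin.val_succ, pow_succ, mul_neg, mul_one,
      neg_mul, Finset.sum_neg_distrib]
    ring
  · exact fun l _ => (hint _ _).const_mul _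
  · exact fun j _ => (hint _ _).const_mul _
  · exact (integrable_finsetSum _ fun j _ => (hint _ _).const_mul _).const_mul _
  · exact (integrable_finsetSum _ fun j _ => (hint _ _).const_mul _).const_mul _

end Stokes

/-! ### Fibre integrals of faces, degeneracies and base changes -/

section Cells

variable {U V : CartSp} {k n p : ℕ}

theorem neg_one_pow_mul_self (k : ℕ) : (-1 : ℝ) ^ k * (-1) ^ k = 1 := by
  rw [← pow_add, ← two_mul, pow_mul]
  simp

theorem sum_smul_fiberForm_apply (h : p + k = n) (β : Fin (k + 2) → Form (tube U k) n)
    (u : U.Space) (v : Fin p → U.Space) :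
    (∑ i : Fin (k + 2), (-1 : ℝ) ^ (i : ℕ) • fiberForm U h (β i)).1 u v =
      ∑ i : Fin (k + 2), (-1) ^ (i : ℕ) * ∫ s in simplex k, (β i).1 (u, s) (frame U h v) := by
  let ev : Omega p U →ₗ[ℝ] ℝ :=
    { toFun := fun η => η.1 u v
      map_add' := fun _ _ => rfl
      map_smul' := fun _ _ => rfl }
  refine (map_sum ev _ _).trans (Finset.sum_congr rfl fun i _ => ?_)
  rw [map_smul, smul_eq_mul]
  exact congrArg _ (fiberIntegral_apply h (β i) u v)

/-- The boundary case of Stokes' theorem, where the faces have full fibre degree `n`: no vectors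
tangent to `U` remain, hence no term `d∫α`. -/
theorem sum_fiberForm_faces_zero (h : 0 + k = n) (h' : 0 + (k + 1) = n + 1)
    (α : Form (tube U (k + 1)) n) :
    ∑ i : Fin (k + 2), (-1 : ℝ) ^ (i : ℕ) •
        fiberForm U h (cellMap n (𝟙 U) (SimplexCategory.δ i) α) =
      (-1 : ℝ) ^ k • fiberForm U h' (extD (isBody_tube U (k + 1)) n α) := by
  apply Form.ext
  intro u _
  ext v
  refine (sum_smul_fiberForm_apply h _ u v).trans ?_
  have e := integral_extD h h' α u v
  simp only [Fin.sum_univ_zero, mul_zero, add_zero] at e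
  change _ = (-1 : ℝ) ^ k * fiberIntegral h' (extD (isBody_tube U (k + 1)) n α) u v
  rw [fiberIntegral_apply, e, ← mul_assoc, neg_one_pow_mul_self, one_mul]

/-- Stokes' theorem for the fibre integral. -/
theorem sum_fiberForm_faces (h : p + 1 + k = n) (h' : p + 1 + (k + 1) = n + 1)
    (h'' : p + (k + 1) = n) (α : Form (tube U (k + 1)) n) :
    ∑ i : Fin (k + 2), (-1 : ℝ) ^ (i : ℕ) •
        fiberForm U h (cellMap n (𝟙 U) (SimplexCategory.δ i) α) =
      dR p U (fiberForm U h'' α) +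
        (-1 : ℝ) ^ k • fiberForm U h' (extD (isBody_tube U (k + 1)) n α) := by
  apply Form.ext
  intro u _
  ext v
  refine (sum_smul_fiberForm_apply h _ u v).trans ?_
  have e := integral_extD h h' α u v
  have e' : ∀ l : Fin (p + 1), Fin.removeNth ⟨k + 1 + l, by omega⟩ (frame U h' v) =
      frame U h'' (l.removeNth v) := fun l => removeNth_fiberVec_horizontal h'' h' _ _ l
  simp only [e'] at e
  change _ = (dR p U (fiberForm U h'' α)).1 u v +
    (-1 : ℝ) ^ k * fiberIntegral h' (extD (isBody_tube U (k + 1)) n α) u v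
  rw [fiberIntegral_apply, e, dR_fiberForm_apply, mul_add, ← mul_assoc, neg_one_pow_mul_self,
    one_mul, ← mul_assoc, pow_succ, ← mul_assoc, neg_one_pow_mul_self]
  ring

theorem fiberVec_rev {X : Type} (h : p + k = n) (w : Fin k → X) (v : Fin p → X) (i : Fin k) :
    fiberVec h w v ⟨k - 1 - i, by omega⟩ = w i := by
  rw [fiberVec_of_lt h w v _ (by omega)]
  congr 1
  ext
  simp
  omega

/-- The fibre integral vanishes on degenerate cells. -/
theorem fiberForm_degenerate {a b : SimplexCategory} (h : p + a.len = n) (θ : a ⟶ b)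
    (hθ : ¬ Function.Injective θ.toOrderHom) (α : Form (tube U b.len) n) :
    fiberForm U h (cellMap n (𝟙 U) θ α) = 0 := by
  refine fiberForm_eq_zero h _ fun u s hs v => ?_
  rw [cellMap_frame h θ α u hs v]
  obtain ⟨x, y, hxy, hlt⟩ : ∃ x y, θ.toOrderHom x = θ.toOrderHom y ∧ x < y := by
    simp only [Function.Injective, not_forall] at hθ
    obtain ⟨x, y, hxy, hne⟩ := hθ
    rcases lt_or_gt_of_ne hne with hl | hl
    · exact ⟨x, y, hxy, hl⟩
    · exact ⟨y, x, hxy.symm, hl⟩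
  obtain ⟨y, rfl⟩ := Fin.exists_succ_eq.2 (Fin.ne_zero_of_lt hlt)
  set w : Fin a.len → U.Space × (Fin b.len → ℝ) := fun i =>
    ((0 : U.Space), vertex (θ.toOrderHom i.succ) - vertex (θ.toOrderHom 0)) with hw
  -- The edges start at the vertex `0`. If that vertex is identified with `y`, one edge vector is
  -- zero; otherwise two edge vectors coincide.
  induction x using Fin.cases with
  | zero =>
    refine ContinuousAlternatingMap.map_coord_zero _ ⟨a.len - 1 - y, by omega⟩ ?_
    rw [fiberVec_rev, hw]
    change ((0 : U.Space), vertex (θ.toOrderHom y.succ) - vertex (θ.toOrderHom 0)) = 0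
    rw [← hxy, sub_self]
    rfl
  | succ x =>
    have hlt' : x < y := Fin.succ_lt_succ_iff.1 hlt
    refine ContinuousAlternatingMap.map_eq_zero_of_eq _ _ (i := ⟨a.len - 1 - x, by omega⟩)
      (j := ⟨a.len - 1 - y, by omega⟩) ?_ ?_
    · rw [fiberVec_rev, fiberVec_rev, hw]
      simp only [hxy]
    · rw [Ne, Fin.mk.injEq]
      rw [Fin.lt_def] at hlt'
      omega

theorem extD_cellMap (f : U ⟶ V) {a b : SimplexCategory} (θ : a ⟶ b) (α : Form (tube V b.len) n) :
    extD (isBody_tube U a.len) n (cellMap n f θ α) =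
      cellMap (n + 1) f θ (extD (isBody_tube V b.len) n α) :=
  extD_pullback _ _ _ _ _ α

/-- The fibre integral is natural in the base. -/
theorem fiberForm_cellMap {a : SimplexCategory} (h : p + a.len = n) (f : U ⟶ V)
    (α : Form (tube V a.len) n) :
    fiberForm U h (cellMap n f (𝟙 a) α) = pullU p f (fiberForm V h α) := by
  apply Form.ext
  intro u hu
  refine Eq.trans ?_ (pullback_apply f.1 f.2 (Set.mapsTo_univ _ _) (fiberForm V h α) hu).symm
  ext v
  change fiberIntegral h (cellMap n f (𝟙 a) α) u v =
    fiberIntegral h α (f.1 u) (fderiv ℝ f.1 u ∘ v)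
  rw [fiberIntegral_apply, fiberIntegral_apply]
  refine MeasureTheory.setIntegral_congr_fun (measurableSet_simplex a.len) fun s hs => ?_
  have hx : (u, s) ∈ tube U a.len := ⟨Set.mem_univ _, hs⟩
  refine (congrArg (fun φ => φ (frame U h v)) (cellMap_apply f (𝟙 a) α hx)).trans ?_
  have e : ⇑(SimplexCategory.Hom.toOrderHom (𝟙 a)) = id := by
    rw [SimplexCategory.id_toOrderHom]
    rfl
  rw [e]
  change α.1 (f.1 u, simplexMap id s)
    (((fderiv ℝ f.1 u).prodMap (fderiv ℝ (simplexMap id) s)) ∘ frame U h v) = _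
  rw [frame, comp_fiberVec, simplexMap_id]
  congr 2
  · funext i
    simp [vert]
  · funext l
    simp

end Cells

/-! ### The chain maps -/

section ChainMaps

/-- The fibre integral of `α`, as an element of the Deligne complex. -/
def upInt (n k : ℕ) (U : CartSp) : Form (tube U k) n →ₗ[ℝ] UpRow n k U :=
  LinearMap.pi fun p => fiberForm U p.2

/-- The fibre integral of `dα`, as an element of the second row of the cone complex. -/
def lowInt (n k : ℕ) (U : CartSp) : Form (tube U k) n →ₗ[ℝ] LowRow n k U :=
  LinearMap.pi fun p => fiberForm U (show p.1 + 1 + k = n + 1 by omega) ∘ₗ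
    extD (isBody_tube U k) n

variable {n k : ℕ} {U V : CartSp}

theorem upInt_cellMap (f : U ⟶ V) (α : Form (tube V k) n) :
    upInt n k U (cellMap n f (𝟙 (SimplexCategory.mk k)) α) = pullUp n k f (upInt n k V α) :=
  funext fun p => fiberForm_cellMap (a := SimplexCategory.mk k) p.2 f α

theorem lowInt_cellMap (f : U ⟶ V) (α : Form (tube V k) n) :
    lowInt n k U (cellMap n f (𝟙 (SimplexCategory.mk k)) α) = pullLow n k f (lowInt n k V α) :=
  funext fun p => by
    have h : p.1 + 1 + k = n + 1 := by omega
    change fiberForm U h (extD (isBody_tube U k) n _) =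
      pullU (p.1 + 1) f (fiberForm V h (extD (isBody_tube V k) n α))
    rw [← fiberForm_cellMap (a := SimplexCategory.mk k) h f]
    exact congrArg _ (extD_cellMap f (𝟙 (SimplexCategory.mk k)) α)

/-- In fibre degree `n + 1` all arguments of `dα` are tangent to the simplex, which is the situation
excluded by the defining condition of `exp_diff`. -/
theorem fiberForm_extD_eq_zero (h : 0 + k = n + 1) {α : Form (tube U k) n}
    (hα : α ∈ (diffFamily n).cells U k) : fiberForm U h (extD (isBody_tube U k) n α) = 0 := by
  refine fiberForm_eq_zero h _ fun u t ht v => ?_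
  obtain rfl : k = n + 1 := by omega
  have e : frame U h v = fun i => ((0 : U.Space), (frame U h v i).2) := by
    funext i
    refine Prod.ext ?_ rfl
    obtain ⟨i, hi⟩ := i
    rw [frame, fiberVec_of_lt h _ _ hi hi]
    rfl
  rw [e]
  exact hα (u, t) ⟨Set.mem_univ _, ht⟩ _

/-- In form degree `0` the right side is zero by the cutoff of the complexes; there the curvature
condition on `α` enters. In the other degrees this is Stokes' theorem. -/
theorem sum_upInt_faces {α : Form (tube U (k + 1)) n} (hα : α ∈ (diffFamily n).cells U (k + 1)) :
    ∑ i : Fin (k + 2), (-1 : ℝ) ^ (i : ℕ) •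
        upInt n k U (cellMap n (𝟙 U) (SimplexCategory.δ i) α) =
      dUp n k U (upInt n (k + 1) U α) +
        (-1 : ℝ) ^ k • lowToUp n k U (lowInt n (k + 1) U α) := by
  funext ⟨p, h⟩
  rw [Finset.sum_apply]
  match p, h with
  | 0, h =>
    refine (sum_fiberForm_faces_zero h (by omega) α).trans ?_
    rw [fiberForm_extD_eq_zero _ hα, smul_zero]
    change (0 : Omega 0 U) = 0 + (-1 : ℝ) ^ k • 0
    rw [smul_zero, add_zero]
  | p + 1, h => exact sum_fiberForm_faces h (by omega) (by omega) α

theorem sum_lowInt_faces {α : Form (tube U (k + 1)) n} (hα : α ∈ (diffFamily n).cells U (k + 1)) :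
    ∑ i : Fin (k + 2), (-1 : ℝ) ^ (i : ℕ) •
        lowInt n k U (cellMap n (𝟙 U) (SimplexCategory.δ i) α) =
      dLow n k U (lowInt n (k + 1) U α) := by
  funext ⟨p, h, hk⟩
  rw [Finset.sum_apply]
  have h1 : p + 1 + k = n + 1 := by omega
  have key : ∑ i : Fin (k + 2), (-1 : ℝ) ^ (i : ℕ) • fiberForm U h1
        (extD (isBody_tube U k) n (cellMap n (𝟙 U) (SimplexCategory.δ i) α)) =
      dR p U (fiberForm U (by omega) (extD (isBody_tube U (k + 1)) n α)) := by
    -- Stokes' theorem for `dα` in place of `α`; its last term contains `ddα = 0`.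
    have := sum_fiberForm_faces h1 (by omega) (by omega) (extD (isBody_tube U (k + 1)) n α)
    rw [extD_extD, map_zero, smul_zero, add_zero] at this
    rw [← this]
    refine Finset.sum_congr rfl fun i _ => ?_
    exact congrArg (fun β => (-1 : ℝ) ^ (i : ℕ) • fiberForm U h1 β)
      (extD_cellMap (𝟙 U) (SimplexCategory.δ i) α)
  refine key.trans ?_
  match p, h with
  | 0, h =>
    -- Here the second row has no source term, so `d∫dα` has to vanish by itself; the simplex has
    -- dimension `n + 1`.
    rw [fiberForm_extD_eq_zero _ hα, map_zero]
    rfl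
  | p + 1, h => rfl

/-- The second row exists only for `k ≥ 1`, so the frame begins with a vector tangent to the
simplex, and its contraction with `dα` is zero. -/
theorem lowInt_eq_zero {α : Form (tube U k) n} (hα : α ∈ (connFamily n).cells U k) :
    lowInt n k U α = 0 := by
  funext ⟨p, h, hk⟩
  obtain ⟨k, rfl⟩ := Nat.exists_eq_add_of_le' hk
  have h1 : p + 1 + (k + 1) = n + 1 := by omega
  refine fiberForm_eq_zero h1 _ fun u t ht v => ?_
  rw [frame, fiberVec_succ (by omega) h1]
  exact hα.2 (u, t) ⟨Set.mem_univ _, ht⟩ _ _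

theorem σ_not_injective (j : Fin (k + 1)) :
    ¬ Function.Injective (SimplexCategory.σ j).toOrderHom := by
  intro h
  have e : j.predAbove j.castSucc = j.predAbove j.succ := by simp
  exact (Fin.castSucc_lt_succ).ne (h e)

theorem upInt_degenerate (j : Fin (k + 1)) (α : Form (tube U k) n) :
    upInt n (k + 1) U (cellMap n (𝟙 U) (SimplexCategory.σ j) α) = 0 :=
  funext fun p => fiberForm_degenerate p.2 (SimplexCategory.σ j) (σ_not_injective j) α

theorem lowInt_degenerate (j : Fin (k + 1)) (α : Form (tube U k) n) :
    lowInt n (k + 1) U (cellMap n (𝟙 U) (SimplexCategory.σ j) α) = 0 :=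
  funext fun p => by
    have h : p.1 + 1 + (k + 1) = n + 1 := by omega
    refine (congrArg (fiberForm U h) (extD_cellMap (𝟙 U) (SimplexCategory.σ j) α)).trans ?_
    exact fiberForm_degenerate h (SimplexCategory.σ j) (σ_not_injective j) _

variable (n k)

/-- Fibre integration of the cells of `exp_Δ(b^(n-1)ℝ)_diff`, as a morphism of presheaves. -/
def intDiff : (expDiff n).obj (op (SimplexCategory.mk k)) ⟶ coneX n k where
  app U := ModuleCat.ofHom (((upInt n k U.unop).prod (lowInt n k U.unop)) ∘ₗ
    ((diffFamily n).cells U.unop k).subtype)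
  naturality _ _ f := ModuleCat.hom_ext (LinearMap.ext fun α => Prod.ext
    (upInt_cellMap f.unop α.1) (lowInt_cellMap f.unop α.1))

/-- Fibre integration of the cells of `exp_Δ(b^(n-1)ℝ)_conn`, as a morphism of presheaves. -/
def intConn : (expConn n).obj (op (SimplexCategory.mk k)) ⟶ deligneX n k where
  app U := ModuleCat.ofHom (upInt n k U.unop ∘ₗ ((connFamily n).cells U.unop k).subtype)
  naturality _ _ f := ModuleCat.hom_ext (LinearMap.ext fun α => upInt_cellMap f.unop α.1)

variable {n k}

theorem psh_hom_ext {A B : Psh} {f g : A ⟶ B}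
    (h : ∀ (U : CartSp) (a : A.obj (op U)), (f.app (op U)).hom a = (g.app (op U)).hom a) : f = g :=
  NatTrans.ext (funext fun U => ModuleCat.hom_ext (LinearMap.ext fun a => h U.unop a))

theorem alternating_sum_comp_apply {X : SimplicialObject Psh} {B : Psh}
    (f : X.obj (op (SimplexCategory.mk k)) ⟶ B) (U : CartSp)
    (a : (X.obj (op (SimplexCategory.mk (k + 1)))).obj (op U)) :
    ((AlgebraicTopology.AlternatingFaceMapComplex.objD X k ≫ f).app (op U)).hom a =
      ∑ i : Fin (k + 2), (-1 : ℝ) ^ (i : ℕ) •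
        (f.app (op U)).hom (((X.δ i).app (op U)).hom a) := by
  let ev : (X.obj (op (SimplexCategory.mk (k + 1))) ⟶ B) →+ B.obj (op U) :=
    { toFun := fun g => (g.app (op U)).hom a
      map_zero' := rfl
      map_add' := fun _ _ => rfl }
  change ev (AlgebraicTopology.AlternatingFaceMapComplex.objD X k ≫ f) = _
  rw [AlgebraicTopology.AlternatingFaceMapComplex.objD, Preadditive.sum_comp, map_sum]
  refine Finset.sum_congr rfl fun i _ => ?_
  rw [Preadditive.zsmul_comp, map_zsmul, ← Int.cast_smul_eq_zsmul ℝ]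
  push_cast
  rfl

theorem intDiff_comm : intDiff n (k + 1) ≫ coneD n k =
    AlgebraicTopology.AlternatingFaceMapComplex.objD (expDiff n) k ≫ intDiff n k := by
  refine psh_hom_ext fun U α => ?_
  rw [alternating_sum_comp_apply]
  have h : ∑ i : Fin (k + 2), (-1 : ℝ) ^ (i : ℕ) •
      (upInt n k U (cellMap n (𝟙 U) (SimplexCategory.δ i) α.1),
        lowInt n k U (cellMap n (𝟙 U) (SimplexCategory.δ i) α.1)) =
      (∑ i : Fin (k + 2), (-1 : ℝ) ^ (i : ℕ) •
        upInt n k U (cellMap n (𝟙 U) (SimplexCategory.δ i) α.1),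
      ∑ i : Fin (k + 2), (-1 : ℝ) ^ (i : ℕ) •
        lowInt n k U (cellMap n (𝟙 U) (SimplexCategory.δ i) α.1)) := by
    simp only [Prod.smul_mk]
    exact (prod_mk_sum _ _ _).symm
  refine Eq.trans ?_ h.symm
  rw [sum_upInt_faces α.2, sum_lowInt_faces α.2]
  rfl

theorem intConn_comm : intConn n (k + 1) ≫ deligneD n k =
    AlgebraicTopology.AlternatingFaceMapComplex.objD (expConn n) k ≫ intConn n k := by
  refine psh_hom_ext fun U α => ?_
  rw [alternating_sum_comp_apply]
  have h := sum_upInt_faces α.2.1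
  rw [lowInt_eq_zero α.2, map_zero, smul_zero, add_zero] at h
  exact h.symm

variable (n)

/-- Fibre integration on all cells of `exp_Δ(b^(n-1)ℝ)_diff`, as a chain map. -/
def intDiffMap : (AlgebraicTopology.alternatingFaceMapComplex Psh).obj (expDiff n) ⟶ cone n :=
  ChainComplex.ofHom (intDiff n) fun k => by
    rw [cone_d, AlgebraicTopology.alternatingFaceMapComplex_obj_d]
    exact intDiff_comm

/-- Fibre integration on all cells of `exp_Δ(b^(n-1)ℝ)_conn`, as a chain map. -/
def intConnMap : (AlgebraicTopology.alternatingFaceMapComplex Psh).obj (expConn n) ⟶ deligne n :=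
  ChainComplex.ofHom (intConn n) fun k => by
    rw [deligne_d, AlgebraicTopology.alternatingFaceMapComplex_obj_d]
    exact intConn_comm

theorem isFiberIntegration_intDiff (k : ℕ) : IsFiberIntegration (intDiff n k) := by
  rintro U α _ rfl
  exact ⟨fun p u => rfl, fun p u => rfl⟩

theorem σ_intDiff (k : ℕ) (j : Fin (k + 1)) : (expDiff n).σ j ≫ intDiff n (k + 1) = 0 :=
  psh_hom_ext fun _ α => Prod.ext (upInt_degenerate j α.1) (lowInt_degenerate j α.1)

theorem expInclusion_intDiffMap :
    (AlgebraicTopology.alternatingFaceMapComplex Psh).map (expInclusion n) ≫ intDiffMap n =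
      intConnMap n ≫ deligneToCone n := by
  refine HomologicalComplex.hom_ext _ _ fun k => ?_
  exact psh_hom_ext fun _ α => Prod.ext rfl (lowInt_eq_zero α.2)

/-- Naturality of the Dold–Kan bijection in both variables, together with that of the inclusion of
the normalized complex, turns a commuting square of chain maps on all cells into one of simplicial
presheaves. -/
theorem comp_ofChainMap {X Y : SimplicialObject Psh} {C D : ChainComplex Psh ℕ} (f : X ⟶ Y)
    (φ : (AlgebraicTopology.alternatingFaceMapComplex Psh).obj Y ⟶ D)
    (ψ : (AlgebraicTopology.alternatingFaceMapComplex Psh).obj X ⟶ C) (g : C ⟶ D)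
    (h : (AlgebraicTopology.alternatingFaceMapComplex Psh).map f ≫ φ = ψ ≫ g) :
    f ≫ ofChainMap (AlgebraicTopology.inclusionOfMooreComplexMap Y ≫ φ) =
      ofChainMap (AlgebraicTopology.inclusionOfMooreComplexMap X ≫ ψ) ≫
        Abelian.DoldKan.Γ.map g := by
  refine ((Abelian.DoldKan.equivalence.toAdjunction.homEquiv_naturality_left f _).symm.trans ?_).trans
    (Abelian.DoldKan.equivalence.toAdjunction.homEquiv_naturality_right _ g)
  congr 1
  have e := (AlgebraicTopology.inclusionOfMooreComplex Psh).naturality f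
  exact (Category.assoc _ _ _).symm.trans ((congrArg (· ≫ φ) e).trans ((Category.assoc _ _ _).trans
    ((congrArg (AlgebraicTopology.inclusionOfMooreComplexMap X ≫ ·) h).trans
      (Category.assoc _ _ _).symm)))

end ChainMaps

end FiberIntegration

open FiberIntegration AlgebraicTopology in
theorem mainTheorem8 (n : ℕ) (hn : 1 ≤ n) :
    ∃ (I : (alternatingFaceMapComplex Psh).obj (expDiff n) ⟶ cone n)
      (J : (alternatingFaceMapComplex Psh).obj (expConn n) ⟶ deligne n)
      (Φ : expDiff n ⟶ BDiff n) (Ψ : expConn n ⟶ BConn n),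
      -- `α ↦ (∫ α, ∫ dα)` is a chain map, on all cells with the alternating sum of the faces as
      -- differential; it vanishes on degenerate cells
      (∀ k : ℕ, IsFiberIntegration (I.f k)) ∧
      (∀ (k : ℕ) (j : Fin (k + 1)), (expDiff n).σ j ≫ I.f (k + 1) = 0) ∧
      -- on cells of `exp_conn` it takes values in the Deligne complex
      (alternatingFaceMapComplex Psh).map (expInclusion n) ≫ I = J ≫ deligneToCone n ∧
      -- its restriction to the normalized complex induces, under the Dold-Kan correspondence,
      -- a morphism of smooth infinity-groupoids, which restricts to `exp_conn`
      Φ = ofChainMap (inclusionOfMooreComplexMap (expDiff n) ≫ I) ∧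
      Ψ = ofChainMap (inclusionOfMooreComplexMap (expConn n) ≫ J) ∧
      expInclusion n ≫ Φ = Ψ ≫ BInclusion n ∧
      IsSmoothInftyGroupoid (underlying.obj (expDiff n)) ∧
      IsSmoothInftyGroupoid (underlying.obj (expConn n)) ∧
      IsSmoothInftyGroupoid (underlying.obj (BDiff n)) ∧
      IsSmoothInftyGroupoid (underlying.obj (BConn n)) ∧
      -- the forms with sitting instants are stable under base change and all face maps
      (∀ (U V : CartSp) (f : U ⟶ V) (a b : SimplexCategory) (θ : a ⟶ b)
        (α : Form (tube V b.len) n), Function.Injective θ.toOrderHom →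
          HasSittingInstants α → HasSittingInstants (cellMap n f θ α)) :=
  ⟨intDiffMap n, intConnMap n, _, _, isFiberIntegration_intDiff n, σ_intDiff n,
    expInclusion_intDiffMap n, rfl, rfl,
    comp_ofChainMap (expInclusion n) (intDiffMap n) (intConnMap n) (deligneToCone n)
      (expInclusion_intDiffMap n),
    isSmoothInftyGroupoid_underlying _, isSmoothInftyGroupoid_underlying _,
    isSmoothInftyGroupoid_underlying _, isSmoothInftyGroupoid_underlying _,
    fun _ _ f _ _ θ _ hθ hα => hα.cellMap f θ hθ⟩
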